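/- Fix $\zeta\in\mathbb C^*$ and a reference parameter $m_0\in\mathbb C^*$. Let $\Sigma=\{(z,s)\in\mathbb C^2: s^2=z^2+2m_0\}$, with its complex orientation and with $\pi(z,s)=z$, $w=1/z$. Let $\infty_-$ (top, $s\sim z$) and $\infty_+$ (bottom, $s\sim -z$) be its two punctures over $w=0$, put $\epsilon=+1$ near $\infty_-$ and $\epsilon=-1$ near $\infty_+$, and let $t_\pm$ be fixed holomorphic coordinates centred at the branch points $b_\pm=(\pm\sqrt{-2m_0},0)$. A framed abelian connection is $\nabla=d+\alpha$, where $\alpha$ is a smooth closed complex $1$-form on $\Sigma\setminus\{b_\pm\}$ such that for some $m\in\mathbb C^*$, $m^{(3)}\in\mathbb R$, near the punctures $$\alpha=\epsilon\,\pi^*\Big[-\zeta^{-1}\tfrac{dw}{w^3}-\zeta\tfrac{d\bar w}{\bar w^3}-(\zeta^{-1}m-\tfrac12m^{(3)})\tfrac{dw}{w}-(\zeta\bar m+\tfrac12m^{(3)})\tfrac{d\bar w}{\bar w}\Big],$$ and $\alpha=\pm\frac{dt_\pm}{2t_\pm}$ near $b_\pm$. Its variations are the smooth closed $1$-forms $\dot\alpha$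 on $\Sigma$ which vanish near $b_\pm$ and, for some $\dot m\in\mathbb C$, $\dot m^{(3)}\in\mathbb R$, equal $\epsilon\,\pi^*\big[-(\zeta^{-1}\dot m-\tfrac12\dot m^{(3)})\frac{dw}{w}-(\zeta\bar{\dot m}+\tfrac12\dot m^{(3)})\frac{d\bar w}{\bar w}\big]$ near the punctures. Regularized form. Let $\Sigma_r=\{|w|\ge r\}\subset\Sigma$. With $w=\varrho e^{i\theta}$ and $\dot\alpha_i=\epsilon\big[(\mu_i+O(\varrho))\,d\theta+(\lambda_i+O(\varrho))\frac{d\varrho}{\varrho}\big]$ near the punctures, put $\mathcal R^{\mathrm{ab}}=2(\mu_1\lambda_2-\mu_2\lambda_1)$ and $$\Omega^{\mathrm{reg},\mathrm{ab}}(\dot\alpha_1,\dot\alpha_2)=\lim_{r\to0^+}\Big[\int_{\Sigma_r}\dot\alpha_1\wedge\dot\alpha_2-2\pi\log r\cdot\mathcal R^{\mathrm{ab}}\Big].$$ Glued form. Let $0<r<\rho\le R$ with $2|m_0|R^2<1$, and restrict to connections and variations whose prescribed form near the punctures holds on $0<|w|<R$. Let $\vartheta\in\mathbb R$ and let $\sigma$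 be the map between the two ends of $\Sigma$ that exchanges the sheets and acts by $w\mapsto e^{i\vartheta}\bar w$; gluing the boundary circles of $\Sigma_r$ by $\sigma$ gives a torus $T$, and a $1$-form $\beta$ on $\Sigma_r$ is regarded as a form on $T$ if $\beta=\sigma^*\beta$ near the top boundary circle. Let $\alpha\mapsto\chi(\alpha)$ be any smoothly varying family of smooth functions on $\Sigma_r$, extended smoothly to $\Sigma$ by the formula below, such that for $|w|<\rho$ $$\chi(\alpha)=\tfrac{\epsilon}{2}\Big[\tfrac12(\zeta^{-1}+\zeta e^{2i\vartheta})w^{-2}+\tfrac12(\zeta+\zeta^{-1}e^{-2i\vartheta})\bar w^{-2}-2(\zeta^{-1}m+\zeta\bar m)\log|w|\Big].$$ Put $\Gamma_\chi(\alpha)=\alpha-d\chi(\alpha)$, let $\dot\chi_i$ be the variation of $\chi(\alpha)$ induced by $\dot\alpha_i$, and let $\Omega^{\mathrm{glue}}$ be the pullback by $\Gamma_\chi$ of the Atiyah–Bott form $\int_T\dot\beta_1\wedge\dot\beta_2$, that is, $$\Omega^{\mathrm{glue}}(\dot\alpha_1,\dot\alpha_2)=\int_{\Sigma_r}(\dot\alpha_1-d\dot\chi_1)\wedge(\dot\alpha_2-d\dot\chi_2).$$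 Then such families $\chi$ exist, and for each of them, each such $\alpha$ and all such variations: $\Gamma_\chi(\alpha)$ (off $b_\pm$) and $\dot\alpha_i-d\dot\chi_i$ are smooth closed forms on $\Sigma_r$ satisfying the gluing condition; the polar coefficients and the limit defining $\Omega^{\mathrm{reg},\mathrm{ab}}$ exist; and $$\Omega^{\mathrm{glue}}(\dot\alpha_1,\dot\alpha_2)=\Omega^{\mathrm{reg},\mathrm{ab}}(\dot\alpha_1,\dot\alpha_2).$$ In particular $\Omega^{\mathrm{glue}}$ does not depend on $r$, $\vartheta$ or the interior values of $\chi$. Moreover $\Omega^{\mathrm{glue}}(\dot\alpha_1,\dot\alpha_2)=\int_{\Sigma_r}\dot\alpha_1\wedge\dot\alpha_2+\int_{\partial\Sigma_r}(\dot\chi_2\dot\alpha_1-\dot\chi_1\dot\alpha_2+\dot\chi_1d\dot\chi_2)$, and the boundary integral equals $-2\pi\log r\cdot\mathcal R^{\mathrm{ab}}$. -/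

import Mathlib

open scoped ContDiff Topology ComplexConjugate

noncomputable section

namespace SpectralGluing

/-! ## The spectral curve -/

/-- The reference spectral curve `Σ = {(z, s) : s ^ 2 = z ^ 2 + 2 m₀}` with `m₀ ≠ 0`.
It is described in the global holomorphic coordinate `u = z + s`, which identifies it with
`ℂ \ {0}` (see `bijOn_spectralCurve`). The branch points `b₊`, `b₋` of the projection to the
`z`-line are `(± b, 0)` with `b ^ 2 = - 2 m₀`; their `u`-coordinates are `b` and `- b`.
The functions `tPlus`, `tMinus` are fixed holomorphic coordinates centred at `b₊`, `b₋`. -/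
structure SpectralCurve where
  m₀ : ℂ
  m₀_ne : m₀ ≠ 0
  b : ℂ
  b_sq : b ^ 2 = -2 * m₀
  tPlus : ℂ → ℂ
  tPlus_analytic : AnalyticAt ℂ tPlus b
  tPlus_zero : tPlus b = 0
  tPlus_deriv : deriv tPlus b ≠ 0
  tMinus : ℂ → ℂ
  tMinus_analytic : AnalyticAt ℂ tMinus (-b)
  tMinus_zero : tMinus (-b) = 0
  tMinus_deriv : deriv tMinus (-b) ≠ 0

namespace SpectralCurve

variable (X : SpectralCurve)

/-- The function `z` on `Σ`. -/
def z (u : ℂ) : ℂ := (u - 2 * X.m₀ / u) / 2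

/-- The function `s` on `Σ`. -/
def s (u : ℂ) : ℂ := (u + 2 * X.m₀ / u) / 2

/-- `u` is a global coordinate on the spectral curve. -/
theorem bijOn_spectralCurve :
    Set.BijOn (fun u => (X.z u, X.s u)) {u | u ≠ 0}
      {p : ℂ × ℂ | p.2 ^ 2 = p.1 ^ 2 + 2 * X.m₀} := by
  refine ⟨?_, ?_, ?_⟩
  · intro u hu
    have hu' : u ≠ 0 := hu
    simp only [Set.mem_ofPred_eq, z, s]
    field_simp
    ring
  · intro u _ v _ h
    have h1 : X.z u = X.z v := congrArg Prod.fst h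
    have h2 : X.s u = X.s v := congrArg Prod.snd h
    have e : ∀ a, X.z a + X.s a = a := fun a => by simp only [z, s]; ring
    rw [← e u, ← e v, h1, h2]
  · rintro ⟨x, y⟩ h
    have h' : y ^ 2 = x ^ 2 + 2 * X.m₀ := h
    have hm : 2 * X.m₀ = (y - x) * (x + y) := by linear_combination -h'
    have hne : x + y ≠ 0 := by
      intro h0
      rw [h0, mul_zero] at hm
      exact X.m₀_ne (by simpa using hm)
    refine ⟨x + y, hne, ?_⟩
    have hd : 2 * X.m₀ / (x + y) = y - x := by rw [hm]; field_simp
    ext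
    · simp only [z, hd]; ring
    · simp only [s, hd]; ring

/-- The function `w = 1 / z` on `Σ`: the projection `π` to the base, in the coordinate `w`
centred at infinity. -/
def w (u : ℂ) : ℂ := (X.z u)⁻¹

/-- The sign `ε`: it is `+1` at the end `u → ∞` (where `s ∼ z`; this is the puncture `∞₋`, the
"top") and `-1` at the end `u → 0` (where `s ∼ -z`; this is the puncture `∞₊`, the "bottom").
The circle `|u| ^ 2 = 2 |m₀|` separating them is invariant under the sheet exchange
`(z, s) ↦ (z, -s)`, and lies in `|z| ^ 2 ≤ 2 |m₀|`. -/
def eps (u : ℂ) : ℂ := if 2 * ‖X.m₀‖ < ‖u‖ ^ 2 then 1 else -1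

/-- The punctured neighbourhood `0 < |w| < R` of the two punctures, `π⁻¹ (D_R)`. -/
def ends (R : ℝ) : Set ℂ := {u | u ≠ 0 ∧ R⁻¹ < ‖X.z u‖}

/-- The cut off curve `Σ_r = Σ \ π⁻¹ (D_r)`, that is `|w| ≥ r`, including the two points over
`z = 0`. -/
def cutoff (r : ℝ) : Set ℂ := {u | u ≠ 0 ∧ ‖X.z u‖ ≤ r⁻¹}

/-- The inverse of `w` on the top end (`ε = 1`) and on the bottom end (`ε = -1`): the point
with `z = 1 / w` and `s = ε √(1 + 2 m₀ w²) / w`; the principal branch of the root is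
holomorphic for `2 |m₀| |w|² < 1`. -/
def lift (ε w : ℂ) : ℂ := (1 + ε * (1 + 2 * X.m₀ * w ^ 2) ^ (1 / 2 : ℂ)) / w

/-- The gluing map `σ`: it exchanges the two ends and acts by `w ↦ exp (i ϑ) * conj w`. -/
def sigma (ϑ : ℝ) (u : ℂ) : ℂ :=
  X.lift (-X.eps u) (Complex.exp (Complex.I * ϑ) * conj (X.w u))

end SpectralCurve

/-! ## Complex-valued differential forms on the plane -/

/-- Complex-valued `1`-forms in a (real two-dimensional) complex coordinate. -/
abbrev OneForm : Type := ℂ → (ℂ →L[ℝ] ℂ)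

/-- The form `dw` in the coordinate `w`. -/
def dHol : ℂ →L[ℝ] ℂ := ContinuousLinearMap.id ℝ ℂ

/-- The form `d w̄` in the coordinate `w`. -/
def dAnti : ℂ →L[ℝ] ℂ := (Complex.conjCLE : ℂ →L[ℝ] ℂ)

/-- The pullback of a `1`-form. -/
def pullback (f : ℂ → ℂ) (η : OneForm) : OneForm := fun u => (η (f u)).comp (fderiv ℝ f u)

/-- `dη = 0` at the point `u`. -/
def ClosedAt (η : OneForm) (u : ℂ) : Prop :=
  ∀ x y : ℂ, fderiv ℝ η u x y = fderiv ℝ η u y x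

/-- The integral of `η₁ ∧ η₂` over a region, for the complex orientation: the value of
`η₁ ∧ η₂` on `(∂/∂x, ∂/∂y)` is integrated against Lebesgue measure. -/
def wedgeIntegral (S : Set ℂ) (η₁ η₂ : OneForm) : ℂ :=
  ∫ u in S, (η₁ u 1 * η₂ u Complex.I - η₁ u Complex.I * η₂ u 1)

/-- The integral of a `1`-form along a curve parametrized by `[0, 2π]`. -/
def loopIntegral (γ : ℝ → ℂ) (η : OneForm) : ℂ :=
  ∫ θ in (0 : ℝ)..(2 * Real.pi), η (γ θ) (deriv γ θ)

/-- The integral over `∂Σ_r` with its boundary orientation: `Σ_r` is `|w| ≥ r`, so both boundary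
circles `|w| = r` are traversed clockwise in the coordinate `w`. -/
def boundaryIntegral (X : SpectralCurve) (r : ℝ) (η : OneForm) : ℂ :=
  loopIntegral (fun θ => X.lift 1 (r * Complex.exp (-(θ * Complex.I)))) η +
    loopIntegral (fun θ => X.lift (-1) (r * Complex.exp (-(θ * Complex.I)))) η

/-! ## Framed abelian connections and their variations -/

/-- A triple `(m, m⁽³⁾, α)`. It is used both for a connection `d + α` with its parameters, and
for a variation `(ṁ, ṁ⁽³⁾, α̇)` of such data. -/
structure ConnData where
  m : ℂ
  m3 : ℝ
  form : OneForm

/-- The triple `α + τ v`. -/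
def ConnData.shift (α : ConnData) (τ : ℝ) (v : ConnData) : ConnData where
  m := α.m + τ * v.m
  m3 := α.m3 + τ * v.m3
  form := fun u => α.form u + τ • v.form u

/-- The form `α₀` in the coordinate `w`. -/
def framedModel (ζ m : ℂ) (m3 : ℝ) : OneForm := fun w =>
  -((ζ⁻¹ / w ^ 3) • dHol) - (ζ / conj w ^ 3) • dAnti
    - ((ζ⁻¹ * m - m3 / 2) / w) • dHol - ((ζ * conj m + m3 / 2) / conj w) • dAnti

/-- The variation of `α₀`. -/
def framedModelVar (ζ m : ℂ) (m3 : ℝ) : OneForm := fun w =>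
  -(((ζ⁻¹ * m - m3 / 2) / w) • dHol) - ((ζ * conj m + m3 / 2) / conj w) • dAnti

/-- The framed almost-flat connections `d + α` on `Σ` whose framed form holds on `0 < |w| < R`.
The space of all framed abelian connections is the union of these sets over `R > 0`. -/
structure IsFramedConnection (X : SpectralCurve) (ζ : ℂ) (R : ℝ) (α : ConnData) : Prop where
  m_ne : α.m ≠ 0
  smooth : ∀ u, u ≠ 0 → u ≠ X.b → u ≠ -X.b → ContDiffAt ℝ ∞ α.form u
  closed : ∀ u, u ≠ 0 → u ≠ X.b → u ≠ -X.b → ClosedAt α.form u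
  framed : ∀ u ∈ X.ends R, α.form u = X.eps u • pullback X.w (framedModel ζ α.m α.m3) u
  branchPlus : ∀ᶠ u in 𝓝[≠] X.b,
    α.form u = (1 / (2 * X.tPlus u)) • fderiv ℝ X.tPlus u
  branchMinus : ∀ᶠ u in 𝓝[≠] (-X.b),
    α.form u = -((1 / (2 * X.tMinus u)) • fderiv ℝ X.tMinus u)

/-- The variations of framed almost-flat connections: closed forms on `Σ` that vanish near the
branch points and have the varied framed form on `0 < |w| < R`. -/
structure IsVariation (X : SpectralCurve) (ζ : ℂ) (R : ℝ) (v : ConnData) : Prop where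
  smooth : ∀ u, u ≠ 0 → ContDiffAt ℝ ∞ v.form u
  closed : ∀ u, u ≠ 0 → ClosedAt v.form u
  framed : ∀ u ∈ X.ends R, v.form u = X.eps u • pullback X.w (framedModelVar ζ v.m v.m3) u
  branchPlus : ∀ᶠ u in 𝓝 X.b, v.form u = 0
  branchMinus : ∀ᶠ u in 𝓝 (-X.b), v.form u = 0

/-- A variation is the velocity of an actual one-parameter family of framed connections. -/
theorem IsFramedConnection.shift {X : SpectralCurve} {ζ : ℂ} {R : ℝ} {α v : ConnData}
    (hα : IsFramedConnection X ζ R α) (hv : IsVariation X ζ R v) :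
    ∀ᶠ τ in 𝓝 (0 : ℝ), IsFramedConnection X ζ R (α.shift τ v) := by
  have hc : Filter.Tendsto (fun τ : ℝ => α.m + τ * v.m) (𝓝 0) (𝓝 α.m) := by
    have : Continuous (fun τ : ℝ => α.m + τ * v.m) := by fun_prop
    simpa using this.tendsto 0
  filter_upwards [hc.eventually_ne hα.m_ne] with τ hτ
  refine ⟨hτ, ?_, ?_, ?_, ?_, ?_⟩
  · intro u h0 h1 h2
    exact (hα.smooth u h0 h1 h2).add ((hv.smooth u h0).const_smul τ)
  · intro u h0 h1 h2 x y
    have d1 : DifferentiableAt ℝ α.form u :=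
      (hα.smooth u h0 h1 h2).differentiableAt (by simp)
    have d2 : DifferentiableAt ℝ v.form u := (hv.smooth u h0).differentiableAt (by simp)
    have e : fderiv ℝ (α.shift τ v).form u = fderiv ℝ α.form u + τ • fderiv ℝ v.form u :=
      (d1.hasFDerivAt.add (d2.hasFDerivAt.const_smul τ)).fderiv
    have c1 := hα.closed u h0 h1 h2 x y
    have c2 := hv.closed u h0 x y
    rw [e]
    simp only [add_apply, smul_apply, c1, c2]
  · intro u hu
    have f1 := hα.framed u hu
    have f2 := hv.framed u hu
    ext x
    simp only [ConnData.shift, f1, f2, pullback, framedModel, framedModelVar, dHol, dAnti,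
      add_apply, smul_apply,
      ContinuousLinearMap.comp_apply, sub_apply,
      neg_apply, smul_eq_mul, Complex.real_smul, map_add, map_mul,
      Complex.conj_ofReal, Complex.ofReal_add, Complex.ofReal_mul]
    ring
  · filter_upwards [hα.branchPlus, hv.branchPlus.filter_mono nhdsWithin_le_nhds] with u h1 h2
    simp only [ConnData.shift, h1, h2]
    exact (congrArg _ (smul_zero τ)).trans (add_zero _)
  · filter_upwards [hα.branchMinus, hv.branchMinus.filter_mono nhdsWithin_le_nhds] with u h1 h2
    simp only [ConnData.shift, h1, h2]
    exact (congrArg _ (smul_zero τ)).trans (add_zero _)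

/-! ## The gluing construction -/

/-- The explicit gluing function on the ends. -/
def gluingModel (X : SpectralCurve) (ζ : ℂ) (ϑ : ℝ) (m u : ℂ) : ℂ :=
  X.eps u / 2 *
    ((ζ⁻¹ + ζ * Complex.exp (2 * Complex.I * ϑ)) / 2 * (X.w u)⁻¹ ^ 2
      + (ζ + ζ⁻¹ * Complex.exp (-(2 * Complex.I * ϑ))) / 2 * (conj (X.w u))⁻¹ ^ 2
      - 2 * (ζ⁻¹ * m + ζ * conj m) * Real.log ‖X.w u‖)

/-- A smoothly varying family `α ↦ χ(α)` of (logarithms of) gauge transformations which on the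
ends `|w| < ρ` is given by the explicit formula. (Only the restriction to some `Σ_r`, `r < ρ`,
will matter; a function on `Σ_r` with the prescribed form near `∂Σ_r` extends to `Σ` by the same
formula.) -/
structure IsGluingFamily (X : SpectralCurve) (ζ : ℂ) (R ρ ϑ : ℝ)
    (χ : ConnData → ℂ → ℂ) : Prop where
  smooth : ∀ α v, IsFramedConnection X ζ R α → IsVariation X ζ R v → ∀ u, u ≠ 0 →
    ContDiffAt ℝ ∞ (fun p : ℝ × ℂ => χ (α.shift p.1 v) p.2) (0, u)
  formula : ∀ α, IsFramedConnection X ζ R α → ∀ u ∈ X.ends ρ,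
    χ α u = gluingModel X ζ ϑ α.m u

/-- The `1`-forms on the torus `T = Σ_r / σ`, closed off an exceptional set `B`: forms `β` on
`Σ_r` with `β = σ^* β` on the neighbourhood `r ≤ |w| < ρ` of the top boundary circle. -/
structure IsTorusForm (X : SpectralCurve) (r ρ ϑ : ℝ) (B : Set ℂ) (β : OneForm) : Prop where
  smooth : ∀ u ∈ X.cutoff r \ B, ContDiffAt ℝ ∞ β u
  closed : ∀ u ∈ X.cutoff r \ B, ClosedAt β u
  glues : ∀ u ∈ X.cutoff r ∩ X.ends ρ, X.eps u = 1 → β u = pullback (X.sigma ϑ) β u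

/-- The abelian Atiyah-Bott form of the torus `T = Σ_r / σ`; the integral over `T` is the
integral over its fundamental domain `Σ_r`. -/
def torusAtiyahBott (X : SpectralCurve) (r : ℝ) (β₁ β₂ : OneForm) : ℂ :=
  wedgeIntegral (X.cutoff r) β₁ β₂

/-- The connection gluing map `Γ_χ : α ↦ α - dχ(α)`. -/
def gluingMap (χ : ConnData → ℂ → ℂ) (α : ConnData) : OneForm :=
  fun u => α.form u - fderiv ℝ (χ α) u

/-- The variation `χ̇` of `χ(α)` induced by the variation `v` of `α`. -/
def chiVar (χ : ConnData → ℂ → ℂ) (α v : ConnData) : ℂ → ℂ :=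
  fun u => deriv (fun τ : ℝ => χ (α.shift τ v) u) 0

/-- The variation `α̇ - dχ̇` of `Γ_χ(α)` induced by the variation `v` of `α`. -/
def gluingMapVar (χ : ConnData → ℂ → ℂ) (α v : ConnData) : OneForm :=
  fun u => v.form u - fderiv ℝ (chiVar χ α v) u

/-- The glued form: the pullback of the Atiyah-Bott form of the torus under `Γ_χ`. -/
def gluedForm (X : SpectralCurve) (r : ℝ) (χ : ConnData → ℂ → ℂ) (α v₁ v₂ : ConnData) : ℂ :=
  torusAtiyahBott X r (gluingMapVar χ α v₁) (gluingMapVar χ α v₂)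

/-- The boundary correction term `∫_{∂Σ_r} (χ̇₂ α̇₁ - χ̇₁ α̇₂ + χ̇₁ dχ̇₂)`. -/
def boundaryTerm (X : SpectralCurve) (r : ℝ) (χ : ConnData → ℂ → ℂ) (α v₁ v₂ : ConnData) : ℂ :=
  boundaryIntegral X r (fun u =>
    chiVar χ α v₂ u • v₁.form u - chiVar χ α v₁ u • v₂.form u
      + chiVar χ α v₁ u • fderiv ℝ (chiVar χ α v₂) u)

/-! ## The regularized form -/

/-- In polar coordinates `w = ϱ e^{iθ}` at the punctures,
`α̇ = ± ((μ + O(ϱ)) dθ + (l + O(ϱ)) dϱ/ϱ)`, with `+` at the top and `-` at the bottom puncture.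
The coefficient of `dθ` is the value on `∂/∂θ = i w`, and that of `dϱ/ϱ` is the value on
`ϱ ∂/∂ϱ = w`. -/
def HasPolarCoeffs (X : SpectralCurve) (v : ConnData) (μ l : ℂ) : Prop :=
  ∀ ε : ℂ, ε = 1 ∨ ε = -1 →
    (fun w : ℂ => pullback (X.lift ε) v.form w (Complex.I * w) - ε * μ)
      =O[𝓝[≠] 0] (fun w : ℂ => w) ∧
    (fun w : ℂ => pullback (X.lift ε) v.form w w - ε * l) =O[𝓝[≠] 0] (fun w : ℂ => w)

/-- The coefficient of the regularization term, as a function of the polar coefficients. -/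
def regCoeff (μ₁ l₁ μ₂ l₂ : ℂ) : ℂ := 2 * (μ₁ * l₂ - μ₂ * l₁)

/-- The regularized abelian Atiyah-Bott form is defined on `(v₁, v₂)`, with the value `L`. -/
def HasRegularizedValue (X : SpectralCurve) (v₁ v₂ : ConnData) (L : ℂ) : Prop :=
  ∃ μ₁ l₁ μ₂ l₂ : ℂ, HasPolarCoeffs X v₁ μ₁ l₁ ∧ HasPolarCoeffs X v₂ μ₂ l₂ ∧
    Filter.Tendsto
      (fun r : ℝ => wedgeIntegral (X.cutoff r) v₁.form v₂.form
        - 2 * Real.pi * Real.log r * regCoeff μ₁ l₁ μ₂ l₂)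
      (𝓝[>] 0) (𝓝 L)

end SpectralGluing

end

/-! On the ends a variation is exactly `ε w^*(l dϱ/ϱ + μ dθ)` with constants `l`, `μ`. The
prescribed `χ` has variation `ε l log|w|` there, so subtracting `dχ̇` removes precisely the radial
part and leaves `ε μ dθ`. Two multiples of `dθ` have zero wedge product, so the glued integrand
vanishes on the ends and the integral over `Σ_r` does not change as `r` decreases
(`wedge_gluingMapVar_eq_zero`, `gluedForm_eq`).

For closed forms, the glued integrand minus `α̇₁ ∧ α̇₂` is the exact form `d(χ̇₂ α̇₁ - χ̇₁ α̇₂ + χ̇₁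
dχ̇₂)` (`wedge_sub_fderiv`). On the ends this primitive is `log|w| (K dθ + N dϱ/ϱ)` with `K = μ₁ l₂
- μ₂ l₁` (`primitive_apply`). Since the circles are traversed clockwise, each contributes `-2π K log
r`; together they give `-2π log r` times `2K`, the regularization term. Hence the bracket whose
limit is taken is constant for small `r` and equals the glued form.

Stokes' theorem on `Σ_r` (`setIntegral_curl_cutoff`) is obtained by a radial cutoff: the inner piece
extends by zero to a compactly supported form on the plane, and the end piece reduces in polar
coordinates to the fundamental theorem of calculus.

The gluing condition for the connection holds because on the ends `dχ` is the `σ`-anti-invariant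
half of `α` (`gluingMap_eq`, `eq_pullback_sigma`). -/

namespace SpectralGluing

open Complex MeasureTheory Set

namespace SpectralCurve

variable (X : SpectralCurve)

/-! ## Geometry of the spectral curve -/

/-- The condition that `|z|` exceeds the modulus of the branch points. -/
theorem two_mul_norm_m₀_lt {ρ R : ℝ} (hρ : 0 < ρ) (hρR : ρ ≤ R) (hR : 2 * ‖X.m₀‖ * R ^ 2 < 1) :
    2 * ‖X.m₀‖ * ρ ^ 2 < 1 := by
  have : 2 * ‖X.m₀‖ * ρ ^ 2 ≤ 2 * ‖X.m₀‖ * R ^ 2 := by gcongr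
  linarith

theorem norm_m₀_lt_of_mem_ends {R : ℝ} (hR0 : 0 < R) (hR : 2 * ‖X.m₀‖ * R ^ 2 < 1) {u : ℂ}
    (hu : u ∈ X.ends R) : 2 * ‖X.m₀‖ < ‖X.z u‖ ^ 2 := by
  have h1 : R⁻¹ ^ 2 < ‖X.z u‖ ^ 2 := by
    have : 0 < R⁻¹ := by positivity
    have := hu.2
    gcongr
  have h2 : 2 * ‖X.m₀‖ < R⁻¹ ^ 2 := by
    rw [inv_pow, lt_inv_comm₀ (by have := norm_pos_iff.2 X.m₀_ne; positivity) (by positivity),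
      ← one_div, lt_div_iff₀ (by have := norm_pos_iff.2 X.m₀_ne; positivity)]
    linarith
  linarith

/-- Away from the disc containing the branch points, the two ends are separated. -/
theorem norm_sq_ne {u : ℂ} (hu : u ≠ 0) (h : 2 * ‖X.m₀‖ < ‖X.z u‖ ^ 2) :
    ‖u‖ ^ 2 ≠ 2 * ‖X.m₀‖ := by
  intro he
  have hu' : 0 < ‖u‖ := norm_pos_iff.2 hu
  -- On the separating circle the two terms of `z` have equal modulus, so their half difference has
  -- modulus at most `‖u‖`.
  have h1 : ‖X.z u‖ ≤ ‖u‖ := by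
    have : ‖X.z u‖ ≤ (‖u‖ + 2 * ‖X.m₀‖ / ‖u‖) / 2 := by
      simp only [z, norm_div, Complex.norm_ofNat]
      gcongr
      refine (norm_sub_le _ _).trans ?_
      simp
    refine this.trans (le_of_eq ?_)
    rw [← he]
    field_simp
    norm_num
  have : ‖X.z u‖ ^ 2 ≤ ‖u‖ ^ 2 := by gcongr
  linarith

/-- Local constancy of the sign is what allows `ε` to be treated as a constant whenever a formula on
the ends is differentiated. -/
theorem eps_eventuallyEq {u : ℂ} (hu : u ≠ 0) (h : 2 * ‖X.m₀‖ < ‖X.z u‖ ^ 2) :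
    X.eps =ᶠ[𝓝 u] fun _ => X.eps u := by
  have hc : Continuous fun v : ℂ => ‖v‖ ^ 2 := by fun_prop
  rcases lt_or_gt_of_ne (X.norm_sq_ne hu h) with h1 | h1
  · filter_upwards [hc.continuousAt.eventually_lt continuousAt_const h1] with v hv
    simp only [eps, if_neg hv.le.not_gt, if_neg h1.le.not_gt]
  · filter_upwards [continuousAt_const.eventually_lt hc.continuousAt h1] with v hv
    simp only [eps, if_pos hv, if_pos h1]

theorem eps_eq (u : ℂ) : X.eps u = 1 ∨ X.eps u = -1 := by
  unfold eps
  split_ifs <;> simp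

theorem eps_mul_self (u : ℂ) : X.eps u * X.eps u = 1 := by
  rcases X.eps_eq u with h | h <;> simp [h]

theorem z_eq_div {u : ℂ} (hu : u ≠ 0) : X.z u = (u ^ 2 - 2 * X.m₀) / (2 * u) := by
  unfold z
  field_simp

theorem norm_z {u : ℂ} (hu : u ≠ 0) : ‖X.z u‖ = ‖u ^ 2 - 2 * X.m₀‖ / (2 * ‖u‖) := by
  rw [X.z_eq_div hu]
  simp

theorem norm_w (u : ℂ) : ‖X.w u‖ = ‖X.z u‖⁻¹ := by simp [w]

theorem z_ne_zero {ρ : ℝ} (hρ : 0 < ρ) {u : ℂ} (hu : u ∈ X.ends ρ) : X.z u ≠ 0 := by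
  have := hu.2
  have : 0 < ρ⁻¹ := by positivity
  rw [← norm_pos_iff]
  linarith

theorem w_ne_zero {ρ : ℝ} (hρ : 0 < ρ) {u : ℂ} (hu : u ∈ X.ends ρ) : X.w u ≠ 0 :=
  inv_ne_zero (X.z_ne_zero hρ hu)

theorem ends_subset {ρ R : ℝ} (hρ : 0 < ρ) (hρR : ρ ≤ R) : X.ends ρ ⊆ X.ends R := fun u hu =>
  ⟨hu.1, (by gcongr : R⁻¹ ≤ ρ⁻¹).trans_lt hu.2⟩

theorem isOpen_ends (ρ : ℝ) : IsOpen (X.ends ρ) := by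
  have : X.ends ρ = {u : ℂ | u ≠ 0} ∩ {u | ρ⁻¹ * (2 * ‖u‖) < ‖u ^ 2 - 2 * X.m₀‖} := by
    ext u
    simp only [ends, mem_ofPred_eq, mem_inter_iff]
    refine and_congr_right fun hu => ?_
    rw [X.norm_z hu, lt_div_iff₀ (by have := norm_pos_iff.2 hu; positivity)]
  rw [this]
  exact isOpen_ne.inter (isOpen_lt (by fun_prop) (by fun_prop))

/-- Clearing the denominator gives a closed inequality on all of `ℂ` that excludes `u = 0`
automatically, because `m₀ ≠ 0`; quadratic against linear growth bounds `u`. -/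
theorem isCompact_cutoff (r : ℝ) : IsCompact (X.cutoff r) := by
  have h : X.cutoff r = {u : ℂ | ‖u ^ 2 - 2 * X.m₀‖ ≤ r⁻¹ * (2 * ‖u‖)} := by
    ext u
    simp only [cutoff, mem_ofPred_eq]
    constructor
    · rintro ⟨hu, h⟩
      rwa [X.norm_z hu, div_le_iff₀ (by have := norm_pos_iff.2 hu; positivity)] at h
    · intro h
      have hu : u ≠ 0 := by
        rintro rfl
        have := norm_pos_iff.2 X.m₀_ne
        simp at h
        linarith
      refine ⟨hu, ?_⟩
      rwa [X.norm_z hu, div_le_iff₀ (by have := norm_pos_iff.2 hu; positivity)]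
  rw [h]
  refine Metric.isCompact_of_isClosed_isBounded (isClosed_le (by fun_prop) (by fun_prop)) ?_
  -- Beyond this radius `‖u‖ > 1`, so `‖u‖ ^ 2` exceeds `2 |r⁻¹| ‖u‖ + 2 ‖m₀‖`. The absolute value
  -- is there because `r` has no sign assumption.
  refine (Metric.isBounded_closedBall (x := (0 : ℂ)) (r := 2 * |r⁻¹| + 2 * ‖X.m₀‖ + 1)).subset ?_
  intro u hu
  rw [mem_closedBall_zero_iff]
  have h1 : ‖u‖ ^ 2 - 2 * ‖X.m₀‖ ≤ ‖u ^ 2 - 2 * X.m₀‖ := by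
    have := norm_sub_norm_le (u ^ 2) (2 * X.m₀)
    simpa using this
  have h2 : ‖u ^ 2 - 2 * X.m₀‖ ≤ r⁻¹ * (2 * ‖u‖) := hu
  have h3 : r⁻¹ * (2 * ‖u‖) ≤ |r⁻¹| * (2 * ‖u‖) := by gcongr; exact le_abs_self _
  by_contra! h4
  have := abs_nonneg r⁻¹
  have := norm_nonneg X.m₀
  have := norm_nonneg u
  nlinarith

/-- The derivative of `w` on the ends. -/
noncomputable def wDeriv (u : ℂ) : ℂ := -((1 + 2 * X.m₀ / u ^ 2) / 2) / X.z u ^ 2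

theorem hasDerivAt_z {u : ℂ} (hu : u ≠ 0) : HasDerivAt X.z ((1 + 2 * X.m₀ / u ^ 2) / 2) u := by
  have h := ((hasDerivAt_id u).sub ((hasDerivAt_const u (2 * X.m₀)).div (hasDerivAt_id u) hu)).div_const 2
  refine h.congr_deriv ?_
  simp
  ring

theorem hasDerivAt_w {u : ℂ} (hu : u ≠ 0) (hz : X.z u ≠ 0) : HasDerivAt X.w (X.wDeriv u) u :=
  (X.hasDerivAt_z hu).inv hz

theorem fderiv_w_apply {u : ℂ} (hu : u ≠ 0) (hz : X.z u ≠ 0) (x : ℂ) :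
    fderiv ℝ X.w u x = X.wDeriv u * x := by
  rw [(X.hasDerivAt_w hu hz).complexToReal_fderiv.fderiv]
  simp

theorem contDiffAt_z {u : ℂ} (hu : u ≠ 0) : ContDiffAt ℝ ∞ X.z u := by
  have h : ContDiffAt ℝ ∞ (fun v : ℂ => (v - 2 * X.m₀ * v⁻¹) * 2⁻¹) u :=
    (contDiffAt_id.sub (contDiffAt_const.mul (contDiffAt_id.inv hu))).mul contDiffAt_const
  exact h

theorem contDiffAt_w {u : ℂ} (hu : u ≠ 0) (hz : X.z u ≠ 0) : ContDiffAt ℝ ∞ X.w u :=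
  (X.contDiffAt_z hu).inv hz

/-! ## The inverse of `w` on the ends -/

section Lift

variable {X} {ε w : ℂ}

/-- The radicand lies in the right half plane, and halving its argument keeps the root there.
Positivity of the real part of the root later decides which sheet a lift belongs to. -/
theorem exists_root (hw : 2 * ‖X.m₀‖ * ‖w‖ ^ 2 < 1) :
    1 + 2 * X.m₀ * w ^ 2 ∈ slitPlane ∧
    ((1 + 2 * X.m₀ * w ^ 2) ^ (1 / 2 : ℂ)) ^ 2 = 1 + 2 * X.m₀ * w ^ 2 ∧
      0 < ((1 + 2 * X.m₀ * w ^ 2) ^ (1 / 2 : ℂ)).re := by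
  set p := 1 + 2 * X.m₀ * w ^ 2 with hp
  have hre : 0 < p.re := by
    have h1 : ‖2 * X.m₀ * w ^ 2‖ < 1 := by simpa using hw
    have h2 := abs_re_le_norm (2 * X.m₀ * w ^ 2)
    have h3 := neg_abs_le (2 * X.m₀ * w ^ 2).re
    rw [hp, add_re, one_re]
    linarith
  have hp0 : p ≠ 0 := by
    rintro h
    simp [h] at hre
  refine ⟨Or.inl hre, ?_, ?_⟩
  · rw [one_div]
    exact cpow_ofNat_inv_pow p 2
  · rw [cpow_def_of_ne_zero hp0, exp_re]
    refine mul_pos (Real.exp_pos _) (Real.cos_pos_of_mem_Ioo ?_)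
    have h1 : (Complex.log p * (1 / 2)).im = arg p / 2 := by
      rw [mul_im, log_im]
      norm_num
      ring
    rw [h1]
    have h2 := abs_arg_lt_pi_div_two_iff.2 (Or.inl hre)
    rw [abs_lt] at h2
    have := Real.pi_pos
    constructor <;> linarith

/-- With `q` the root, `(1 + εq)(1 - εq) = -2 m₀ w²`. So neither factor vanishes, and the test
defining `eps` becomes `|1 - εq| < |1 + εq|`, that is, `Re (εq) > 0`. -/
theorem lift_spec (hε : ε = 1 ∨ ε = -1) (hw0 : w ≠ 0) (hw : 2 * ‖X.m₀‖ * ‖w‖ ^ 2 < 1) :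
    X.lift ε w ≠ 0 ∧ X.z (X.lift ε w) = w⁻¹ ∧ X.eps (X.lift ε w) = ε := by
  obtain ⟨-, h2, h3⟩ := exists_root hw
  have hl : X.lift ε w = (1 + ε * (1 + 2 * X.m₀ * w ^ 2) ^ (1 / 2 : ℂ)) / w := rfl
  set q := (1 + 2 * X.m₀ * w ^ 2) ^ (1 / 2 : ℂ)
  have hε2 : ε ^ 2 = 1 := by rcases hε with rfl | rfl <;> norm_num
  have hprod : (1 + ε * q) * (1 - ε * q) = -2 * X.m₀ * w ^ 2 := by
    linear_combination -ε ^ 2 * h2 - (1 + 2 * X.m₀ * w ^ 2) * hε2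
  have hne : 1 + ε * q ≠ 0 := by
    intro h
    rw [h, zero_mul] at hprod
    have : X.m₀ * w ^ 2 ≠ 0 := mul_ne_zero X.m₀_ne (pow_ne_zero 2 hw0)
    apply this
    linear_combination hprod / 2
  have hl0 : X.lift ε w ≠ 0 := by
    rw [hl]
    exact div_ne_zero hne hw0
  refine ⟨hl0, ?_, ?_⟩
  · rw [X.z_eq_div hl0, hl]
    field_simp
    linear_combination ε ^ 2 * h2 + (1 + 2 * X.m₀ * w ^ 2) * hε2
  · have hnorm : 2 * ‖X.m₀‖ * ‖w‖ ^ 2 = ‖1 + ε * q‖ * ‖1 - ε * q‖ := by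
      rw [← norm_mul, hprod]
      simp
    have hwpos : 0 < ‖w‖ := norm_pos_iff.2 hw0
    have hpos : 0 < ‖1 + ε * q‖ := norm_pos_iff.2 hne
    have key : 2 * ‖X.m₀‖ < ‖X.lift ε w‖ ^ 2 ↔ ‖1 - ε * q‖ < ‖1 + ε * q‖ := by
      rw [hl, norm_div, div_pow, lt_div_iff₀ (by positivity), hnorm, sq,
        mul_lt_mul_iff_right₀ hpos]
    have hsq : ‖1 - ε * q‖ < ‖1 + ε * q‖ ↔ 0 < (ε * q).re := by
      rw [← sq_lt_sq₀ (norm_nonneg _) (norm_nonneg _), ← normSq_eq_norm_sq, ← normSq_eq_norm_sq,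
        normSq_add, normSq_sub]
      simp
      constructor <;> intro h <;> linarith
    unfold eps
    rcases hε with rfl | rfl
    · rw [if_pos]
      rw [key, hsq]
      simpa using h3
    · rw [if_neg]
      rw [key, hsq]
      simpa using h3.le

theorem w_lift (hε : ε = 1 ∨ ε = -1) (hw0 : w ≠ 0) (hw : 2 * ‖X.m₀‖ * ‖w‖ ^ 2 < 1) :
    X.w (X.lift ε w) = w := by
  rw [SpectralCurve.w, (lift_spec hε hw0 hw).2.1, inv_inv]

theorem lift_mem_ends {ρ : ℝ} (hε : ε = 1 ∨ ε = -1) (hw0 : w ≠ 0)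
    (hw : 2 * ‖X.m₀‖ * ‖w‖ ^ 2 < 1) (hwρ : ‖w‖ < ρ) : X.lift ε w ∈ X.ends ρ := by
  refine ⟨(lift_spec hε hw0 hw).1, ?_⟩
  rw [(lift_spec hε hw0 hw).2.1, norm_inv]
  have : 0 < ‖w‖ := norm_pos_iff.2 hw0
  gcongr

theorem differentiableAt_lift (hw0 : w ≠ 0) (hw : 2 * ‖X.m₀‖ * ‖w‖ ^ 2 < 1) :
    DifferentiableAt ℝ (X.lift ε) w := by
  have h := (exists_root hw).1
  have : DifferentiableAt ℂ (X.lift ε) w := by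
    unfold lift
    refine DifferentiableAt.div ?_ differentiableAt_id hw0
    refine (differentiableAt_const _).add ((differentiableAt_const _).mul ?_)
    exact DifferentiableAt.cpow (by fun_prop) (by fun_prop) h
  exact this.restrictScalars ℝ

end Lift

/-- Equal values of `z` force `u = v` or `u v = -2 m₀`. The second case is the sheet exchange, which
would put `u` and `v` on opposite sides of the separating circle. -/
theorem injOn_w {ε : ℂ} {R : ℝ} (hR0 : 0 < R) (hR : 2 * ‖X.m₀‖ * R ^ 2 < 1) :
    InjOn X.w (X.ends R ∩ {u | X.eps u = ε}) := by
  rintro u ⟨hu, hue⟩ v ⟨hv, hve⟩ h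
  have hz : X.z u = X.z v := inv_injective h
  have hu0 := hu.1
  have hv0 := hv.1
  have hfac : (u - v) * (u * v + 2 * X.m₀) = 0 := by
    rw [X.z_eq_div hu0, X.z_eq_div hv0] at hz
    field_simp at hz
    linear_combination hz
  rcases mul_eq_zero.1 hfac with h1 | h1
  · exact sub_eq_zero.1 h1
  · exfalso
    have hn : ‖u‖ * ‖v‖ = 2 * ‖X.m₀‖ := by
      rw [← norm_mul, eq_neg_of_add_eq_zero_left h1]
      simp
    have e : X.eps u = X.eps v := by rw [hue, hve]
    have n1 := X.norm_sq_ne hu0 (X.norm_m₀_lt_of_mem_ends hR0 hR hu)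
    have n2 := X.norm_sq_ne hv0 (X.norm_m₀_lt_of_mem_ends hR0 hR hv)
    have pu : 0 < ‖u‖ := norm_pos_iff.2 hu0
    have pv : 0 < ‖v‖ := norm_pos_iff.2 hv0
    have hprod : ‖u‖ ^ 2 * ‖v‖ ^ 2 = (2 * ‖X.m₀‖) ^ 2 := by rw [← mul_pow, hn]
    have pm : 0 < 2 * ‖X.m₀‖ := by rw [← hn]; positivity
    unfold eps at e
    split_ifs at e with a b b
    · nlinarith
    · norm_num at e
    · norm_num at e
    · have a' := lt_of_le_of_ne (not_lt.1 a) n1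
      have b' := lt_of_le_of_ne (not_lt.1 b) n2
      have : ‖u‖ ^ 2 * ‖v‖ ^ 2 < (2 * ‖X.m₀‖) * (2 * ‖X.m₀‖) :=
        mul_lt_mul'' a' b' (by positivity) (by positivity)
      nlinarith

/-- `w` maps each end of `Σ_r` onto the annulus. -/
theorem image_w {ε : ℂ} {r ρ : ℝ} (hε : ε = 1 ∨ ε = -1) (hr : 0 < r) (hρ : 0 < ρ)
    (hR : 2 * ‖X.m₀‖ * ρ ^ 2 < 1) :
    X.w '' (X.cutoff r ∩ (X.ends ρ ∩ {u | X.eps u = ε})) = {w | r ≤ ‖w‖ ∧ ‖w‖ < ρ} := by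
  ext w
  simp only [mem_image, mem_inter_iff, mem_ofPred_eq]
  constructor
  · rintro ⟨u, ⟨hc, hu, -⟩, rfl⟩
    have hz := norm_pos_iff.2 (X.z_ne_zero hρ hu)
    rw [X.norm_w]
    exact ⟨(le_inv_comm₀ hr hz).2 hc.2, (inv_lt_comm₀ hz hρ).2 hu.2⟩
  · rintro ⟨h1, h2⟩
    have hw0 : w ≠ 0 := norm_pos_iff.1 (hr.trans_le h1)
    have hw : 2 * ‖X.m₀‖ * ‖w‖ ^ 2 < 1 :=
      X.two_mul_norm_m₀_lt (norm_pos_iff.2 hw0) h2.le hR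
    obtain ⟨a, b, c⟩ := lift_spec hε hw0 hw
    refine ⟨X.lift ε w, ⟨⟨a, ?_⟩, lift_mem_ends hε hw0 hw h2, c⟩, w_lift hε hw0 hw⟩
    rw [b, norm_inv]
    gcongr

theorem measurableSet_eps_eq (ε : ℂ) : MeasurableSet {u | X.eps u = ε} := by
  have : Measurable X.eps :=
    Measurable.ite (measurableSet_lt (by fun_prop) (by fun_prop)) (by fun_prop) (by fun_prop)
  exact this (measurableSet_singleton ε)

end SpectralCurve

/-! ## Exterior calculus in the plane -/

/-- The coefficient of `dη`: its value on `(∂/∂x, ∂/∂y)`. -/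
noncomputable def curl (η : OneForm) (u : ℂ) : ℂ := fderiv ℝ η u 1 I - fderiv ℝ η u I 1

/-- The coefficient of `η₁ ∧ η₂`: its value on `(∂/∂x, ∂/∂y)`. -/
noncomputable def wedge (η₁ η₂ : OneForm) (u : ℂ) : ℂ := η₁ u 1 * η₂ u I - η₁ u I * η₂ u 1

theorem curl_eq_zero {η : OneForm} {u : ℂ} (h : ClosedAt η u) : curl η u = 0 :=
  sub_eq_zero.2 (h 1 I)

theorem closedAt_fderiv {f : ℂ → ℂ} {u : ℂ} (hf : ContDiffAt ℝ ∞ f u) :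
    ClosedAt (fderiv ℝ f) u := fun x y =>
  (hf.isSymmSndFDerivAt (by
    rw [minSmoothness_of_isRCLikeNormedField]
    exact WithTop.coe_le_coe.2 (le_top : (2 : ℕ∞) ≤ ⊤))) x y

theorem closedAt_sub {η₁ η₂ : OneForm} {u : ℂ} (h₁ : ContDiffAt ℝ ∞ η₁ u)
    (h₂ : ContDiffAt ℝ ∞ η₂ u) (c₁ : ClosedAt η₁ u) (c₂ : ClosedAt η₂ u) :
    ClosedAt (fun v => η₁ v - η₂ v) u := by
  intro x y
  have e := ((h₁.differentiableAt (by simp)).hasFDerivAt.sub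
    (h₂.differentiableAt (by simp)).hasFDerivAt).fderiv
  have e' : fderiv ℝ (fun v => η₁ v - η₂ v) u = fderiv ℝ η₁ u - fderiv ℝ η₂ u := e
  rw [e']
  simp only [sub_apply, c₁ x y, c₂ x y]

theorem contDiffAt_fderiv {f : ℂ → ℂ} {u : ℂ} (hf : ContDiffAt ℝ ∞ f u) :
    ContDiffAt ℝ ∞ (fderiv ℝ f) u :=
  hf.fderiv_right (by simp)

theorem curl_smul {f : ℂ → ℂ} {η : OneForm} {u : ℂ} (hf : DifferentiableAt ℝ f u)
    (hη : DifferentiableAt ℝ η u) :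
    curl (fun v => f v • η v) u = f u * curl η u + wedge (fderiv ℝ f) η u := by
  have e : fderiv ℝ (fun v => f v • η v) u = _ := (hf.hasFDerivAt.smul hη.hasFDerivAt).fderiv
  simp only [curl, wedge, e]
  simp
  ring

theorem curl_add {η₁ η₂ : OneForm} {u : ℂ} (h₁ : DifferentiableAt ℝ η₁ u)
    (h₂ : DifferentiableAt ℝ η₂ u) :
    curl (fun v => η₁ v + η₂ v) u = curl η₁ u + curl η₂ u := by
  have e : fderiv ℝ (fun v => η₁ v + η₂ v) u = _ := (h₁.hasFDerivAt.add h₂.hasFDerivAt).fderiv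
  simp only [curl, e]
  simp
  ring

theorem curl_sub {η₁ η₂ : OneForm} {u : ℂ} (h₁ : DifferentiableAt ℝ η₁ u)
    (h₂ : DifferentiableAt ℝ η₂ u) :
    curl (fun v => η₁ v - η₂ v) u = curl η₁ u - curl η₂ u := by
  have e : fderiv ℝ (fun v => η₁ v - η₂ v) u = _ := (h₁.hasFDerivAt.sub h₂.hasFDerivAt).fderiv
  simp only [curl, e]
  simp
  ring

/-- The change of `η₁ ∧ η₂` under `ηᵢ ↦ ηᵢ - dfᵢ` is exact, for closed `ηᵢ`. -/
theorem wedge_sub_fderiv {η₁ η₂ : OneForm} {f₁ f₂ : ℂ → ℂ} {u : ℂ} (h₁ : ContDiffAt ℝ ∞ η₁ u)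
    (h₂ : ContDiffAt ℝ ∞ η₂ u) (c₁ : ClosedAt η₁ u) (c₂ : ClosedAt η₂ u)
    (hf₁ : ContDiffAt ℝ ∞ f₁ u) (hf₂ : ContDiffAt ℝ ∞ f₂ u) :
    wedge (fun v => η₁ v - fderiv ℝ f₁ v) (fun v => η₂ v - fderiv ℝ f₂ v) u - wedge η₁ η₂ u =
      curl (fun v => f₂ v • η₁ v - f₁ v • η₂ v + f₁ v • fderiv ℝ f₂ v) u := by
  have d₁ := h₁.differentiableAt (by simp)
  have d₂ := h₂.differentiableAt (by simp)
  have e₁ := hf₁.differentiableAt (by simp)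
  have e₂ := hf₂.differentiableAt (by simp)
  have e₃ := (contDiffAt_fderiv hf₂).differentiableAt (by simp)
  have g₁ : DifferentiableAt ℝ (fun v => f₂ v • η₁ v) u := e₂.smul d₁
  have g₂ : DifferentiableAt ℝ (fun v => f₁ v • η₂ v) u := e₁.smul d₂
  have g₃ : DifferentiableAt ℝ (fun v => f₁ v • fderiv ℝ f₂ v) u := e₁.smul e₃
  have g₄ : DifferentiableAt ℝ (fun v => f₂ v • η₁ v - f₁ v • η₂ v) u := g₁.sub g₂
  rw [curl_add g₄ g₃, curl_sub g₁ g₂, curl_smul e₂ d₁, curl_smul e₁ d₂, curl_smul e₁ e₃, curl_eq_zero c₁, curl_eq_zero c₂,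
    curl_eq_zero (closedAt_fderiv hf₂)]
  simp only [wedge, sub_apply]
  ring

theorem continuousAt_wedge {η₁ η₂ : OneForm} {u : ℂ} (h₁ : ContDiffAt ℝ ∞ η₁ u)
    (h₂ : ContDiffAt ℝ ∞ η₂ u) : ContinuousAt (wedge η₁ η₂) u := by
  have c₁ := h₁.continuousAt
  have c₂ := h₂.continuousAt
  have k : ∀ x y : ℂ, ContinuousAt (fun v => η₁ v x * η₂ v y) u := fun x y =>
    (c₁.clm_apply continuousAt_const).mul (c₂.clm_apply continuousAt_const)
  exact (k 1 I).sub (k I 1)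

theorem continuousAt_curl {η : OneForm} {u : ℂ} (h : ContDiffAt ℝ ∞ η u) :
    ContinuousAt (curl η) u := by
  have c : ContinuousAt (fderiv ℝ η) u :=
    (h.fderiv_right (m := ∞) (by simp)).continuousAt
  have k : ∀ x y : ℂ, ContinuousAt (fun v => fderiv ℝ η v x y) u := fun x y =>
    (c.clm_apply continuousAt_const).clm_apply continuousAt_const
  exact (k 1 I).sub (k I 1)

/-- Each directional derivative integrates to zero: integrate by parts against the constant function
`1`. -/
theorem integral_curl_eq_zero {η : OneForm} (hη : ContDiff ℝ 1 η) (hc : HasCompactSupport η) :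
    ∫ u, curl η u = 0 := by
  have hcf : Continuous (fderiv ℝ η) := hη.continuous_fderiv (by simp)
  have hcs : HasCompactSupport (fderiv ℝ η) := hc.fderiv ℝ
  have key : ∀ x y : ℂ, Integrable (fun u => fderiv ℝ η u x y) ∧ ∫ u, fderiv ℝ η u x y = 0 := by
    intro x y
    have hi : Integrable (fun u => fderiv ℝ η u x y) := by
      refine Continuous.integrable_of_hasCompactSupport
        ((hcf.clm_apply continuous_const).clm_apply continuous_const) ?_
      exact hcs.comp_left (g := fun L : ℂ →L[ℝ] ℂ →L[ℝ] ℂ => L x y) (by simp)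
    have hi2 : Integrable (fun u => η u y) := by
      refine Continuous.integrable_of_hasCompactSupport (hη.continuous.clm_apply continuous_const) ?_
      exact hc.comp_left (g := fun L : ℂ →L[ℝ] ℂ => L y) (by simp)
    have e : ∀ u, fderiv ℝ (fun v => η v y) u x = fderiv ℝ η u x y := by
      intro u
      rw [fderiv_clm_apply (hη.differentiable (by simp) u) (differentiableAt_const y)]
      simp
    refine ⟨hi, ?_⟩
    have h := integral_smul_fderiv_eq_neg_fderiv_smul_of_integrable (μ := (volume : Measure ℂ))
      (f := fun _ : ℂ => (1 : ℝ)) (g := fun v => η v y) (v := x) (by simp) (by simpa [e] using hi)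
      (by simpa using hi2) (fun u _ => differentiableAt_const _)
      (fun u _ => ((hη.differentiable (by simp)) u).clm_apply (differentiableAt_const y))
    simpa [e] using h
  unfold curl
  rw [integral_sub (key 1 I).1 (key I 1).1, (key 1 I).2, (key I 1).2, sub_zero]

/-- Stokes' theorem for a form that vanishes outside a compact subset of its domain. -/
theorem setIntegral_curl_eq_zero {η : OneForm} {S U : Set ℂ} (hS : IsCompact S) (hU : IsOpen U)
    (hSU : S ⊆ U) (hη : ∀ u ∈ U, ContDiffAt ℝ 1 η u) (h0 : ∀ u ∈ U, u ∉ S → η u = 0) :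
    ∫ u in S, curl η u = 0 := by
  -- The extension of `η` by zero is `C¹` on the whole plane: it agrees with `η` on `U` and vanishes
  -- on the open complement of `S`, and these two sets cover the plane.
  have hin : ∀ u ∈ U, S.indicator η =ᶠ[𝓝 u] η := by
    intro u hu
    filter_upwards [hU.mem_nhds hu] with v hv
    by_cases hvS : v ∈ S
    · simp [hvS]
    · simp [hvS, h0 v hv hvS]
  have hout : ∀ u ∉ S, S.indicator η =ᶠ[𝓝 u] fun _ => 0 := by
    intro u hu
    filter_upwards [hS.isClosed.isOpen_compl.mem_nhds hu] with v hv
    exact indicator_of_notMem hv η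
  have h1 : ContDiff ℝ 1 (S.indicator η) := by
    rw [contDiff_iff_contDiffAt]
    intro u
    by_cases hu : u ∈ S
    · exact (hη u (hSU hu)).congr_of_eventuallyEq (hin u (hSU hu))
    · exact contDiffAt_const.congr_of_eventuallyEq (hout u hu)
  have h2 : HasCompactSupport (S.indicator η) :=
    HasCompactSupport.intro hS fun u hu => indicator_of_notMem hu η
  rw [← integral_curl_eq_zero h1 h2, ← integral_indicator hS.measurableSet]
  congr 1
  ext u
  by_cases hu : u ∈ S
  · simp only [indicator_of_mem hu, curl, (hin u (hSU hu)).fderiv_eq]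
  · simp [indicator_of_notMem hu, curl, (hout u hu).fderiv_eq]

/-! ### Integration over an end in polar coordinates -/

/-- This is the Jacobian of a holomorphic change of variables; the real determinant of
multiplication by `c` is the field norm of `ℂ` over `ℝ`. -/
theorem det_smul_one (c : ℂ) : (c • (1 : ℂ →L[ℝ] ℂ)).det = ‖c‖ ^ 2 := by
  rw [← normSq_eq_norm_sq, ← Algebra.norm_complex_apply, Algebra.norm_apply]
  rfl

/-- The integral of a radial function over an annulus. -/
theorem setIntegral_annulus_norm (F : ℝ → ℂ) {r ρ : ℝ} (hr : 0 < r) (hrρ : r ≤ ρ) :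
    ∫ w in {w : ℂ | r ≤ ‖w‖ ∧ ‖w‖ < ρ}, F ‖w‖ = 2 * Real.pi * ∫ y in r..ρ, y * F y := by
  have hm : MeasurableSet {w : ℂ | r ≤ ‖w‖ ∧ ‖w‖ < ρ} :=
    (measurableSet_le measurable_const measurable_norm).inter
      (measurableSet_lt measurable_norm measurable_const)
  rw [← integral_indicator hm]
  have e : ({w : ℂ | r ≤ ‖w‖ ∧ ‖w‖ < ρ}.indicator fun w => F ‖w‖) =
      fun w => (Ico r ρ).indicator F ‖w‖ := by
    ext w
    simp only [indicator, mem_ofPred_eq, mem_Ico]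
  rw [e, integral_fun_norm_addHaar volume ((Ico r ρ).indicator F), intervalIntegral.integral_of_le hrρ,
    ← integral_Ico_eq_integral_Ioc]
  have e2 : ∫ y in Ioi (0 : ℝ), y ^ (Module.finrank ℝ ℂ - 1) • (Ico r ρ).indicator F y =
      ∫ y in Ico r ρ, y * F y := by
    have : (fun y : ℝ => y ^ (Module.finrank ℝ ℂ - 1) • (Ico r ρ).indicator F y) =
        (Ico r ρ).indicator fun y => y * F y := by
      ext y
      by_cases hy : y ∈ Ico r ρ <;> simp [hy, Complex.finrank_real_complex]
    rw [this, setIntegral_indicator measurableSet_Ico, inter_eq_right.2]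
    intro y hy
    exact hr.trans_le hy.1
  rw [e2]
  have e3 : (volume : Measure ℂ).real (Metric.ball 0 1) = Real.pi := by
    simp [Measure.real, Complex.volume_ball]
  rw [e3, Complex.finrank_real_complex]
  simp [mul_assoc]

/-- Integration of a function of `|w|` over one end of `Σ_r`. -/
theorem setIntegral_end (X : SpectralCurve) (F : ℝ → ℂ) {ε : ℂ} {r ρ : ℝ} (hε : ε = 1 ∨ ε = -1)
    (hr : 0 < r) (hrρ : r ≤ ρ) (hR : 2 * ‖X.m₀‖ * ρ ^ 2 < 1) :
    ∫ u in X.cutoff r ∩ (X.ends ρ ∩ {u | X.eps u = ε}), (‖X.wDeriv u‖ ^ 2 : ℝ) * F ‖X.w u‖ =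
      2 * Real.pi * ∫ y in r..ρ, y * F y := by
  have hρ : 0 < ρ := hr.trans_le hrρ
  have hm : MeasurableSet (X.cutoff r ∩ (X.ends ρ ∩ {u | X.eps u = ε})) :=
    (X.isCompact_cutoff r).measurableSet.inter
      ((X.isOpen_ends ρ).measurableSet.inter (X.measurableSet_eps_eq ε))
  rw [← setIntegral_annulus_norm F hr hrρ, ← X.image_w hε hr hρ hR,
    integral_image_eq_integral_abs_det_fderiv_smul volume hm
      (f' := fun u => X.wDeriv u • (1 : ℂ →L[ℝ] ℂ))
      (fun u hu => (X.hasDerivAt_w hu.1.1 (X.z_ne_zero hρ hu.2.1)).complexToReal_fderiv.hasFDerivWithinAt)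
      ((X.injOn_w hρ hR).mono inter_subset_right)]
  simp [det_smul_one]

/-! ## The forms on the ends -/

/-- The coefficient of `dθ` in the variation of the framed form. -/
noncomputable def angularCoeff (ζ m : ℂ) (m3 : ℝ) : ℂ :=
  -I * ((ζ⁻¹ * m - m3 / 2) - (ζ * conj m + m3 / 2))

/-- The coefficient of `dϱ/ϱ` in the variation of the framed form. -/
noncomputable def radialCoeff (ζ m : ℂ) : ℂ := -(ζ⁻¹ * m + ζ * conj m)

/-- Here `dw/w = dϱ/ϱ + i dθ`, so `(y / w).re` and `(y / w).im` are the values of `dϱ/ϱ` and `dθ` on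
`y`. The parameter `m3` cancels from the radial coefficient. -/
theorem framedModelVar_apply (ζ m : ℂ) (m3 : ℝ) {w : ℂ} (hw : w ≠ 0) (y : ℂ) :
    framedModelVar ζ m m3 w y =
      radialCoeff ζ m * (y / w).re + angularCoeff ζ m m3 * (y / w).im := by
  obtain ⟨p, rfl⟩ : ∃ p, y = p * w := ⟨y / w, by field_simp⟩
  have hw' : conj w ≠ 0 := by simpa using hw
  rw [mul_div_cancel_right₀ p hw]
  have h1 : framedModelVar ζ m m3 w (p * w) =
      -((ζ⁻¹ * m - m3 / 2) * p) - (ζ * conj m + m3 / 2) * conj p := by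
    simp only [framedModelVar, dHol, dAnti, sub_apply, neg_apply, smul_apply, smul_eq_mul,
      ContinuousLinearMap.id_apply, ContinuousLinearEquiv.coe_coe, conjCLE_apply, map_mul]
    field_simp
  have h2 : p = p.re + p.im * I := (re_add_im p).symm
  have h3 : conj p = p.re - p.im * I := by apply Complex.ext <;> simp
  rw [h1, h3]
  conv_lhs => rw [h2]
  simp only [radialCoeff, angularCoeff, add_re, ofReal_re, mul_re, I_re, I_im, ofReal_im, add_im,
    mul_im]
  push_cast
  ring_nf

theorem hasFDerivAt_log_norm {w : ℂ} (hw : w ≠ 0) :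
    HasFDerivAt (fun w : ℂ => Real.log ‖w‖) (reCLM.comp (w⁻¹ • (1 : ℂ →L[ℝ] ℂ))) w := by
  have h1 := ((hasFDerivAt_id (𝕜 := ℝ) w).norm_sq).log (by simpa using hw)
  have h2 := h1.const_mul (1 / 2 : ℝ)
  have e : (fun w : ℂ => Real.log ‖w‖) = fun w : ℂ => (1 / 2 : ℝ) * Real.log (‖id w‖ ^ 2) := by
    ext v
    simp [Real.log_pow]
  rw [e]
  refine h2.congr_fderiv ?_
  ext y
  simp only [smul_apply, ContinuousLinearMap.comp_apply, smul_eq_mul, reCLM_apply, inv_re, mul_re,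
    inv_im, innerSL_apply_apply, Complex.inner, id, ContinuousLinearMap.id_apply,
    one_apply_eq_self, conj_re, conj_im, nsmul_eq_mul, ← normSq_eq_norm_sq]
  have := normSq_pos.2 hw
  field_simp
  norm_num

theorem contDiffAt_log_norm {w : ℂ} (hw : w ≠ 0) :
    ContDiffAt ℝ ∞ (fun w : ℂ => ((Real.log ‖w‖ : ℝ) : ℂ)) w :=
  ofRealCLM.contDiff.contDiffAt.comp w ((contDiffAt_norm ℝ hw).log (norm_ne_zero_iff.2 hw))

theorem hasFDerivAt_log_norm_w (X : SpectralCurve) {u : ℂ} (hu : u ≠ 0) (hz : X.z u ≠ 0) :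
    HasFDerivAt (fun v => ((Real.log ‖X.w v‖ : ℝ) : ℂ))
      (ofRealCLM.comp (reCLM.comp ((X.wDeriv u / X.w u) • (1 : ℂ →L[ℝ] ℂ)))) u := by
  have hw : X.w u ≠ 0 := inv_ne_zero hz
  have h := ofRealCLM.hasFDerivAt.comp u ((hasFDerivAt_log_norm hw).comp u
      (X.hasDerivAt_w hu hz).complexToReal_fderiv)
  refine h.congr_fderiv ?_
  ext y
  simp only [ContinuousLinearMap.comp_apply, smul_apply, one_apply_eq_self, smul_eq_mul,
    div_eq_inv_mul, mul_assoc]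

theorem IsVariation.form_apply {X : SpectralCurve} {ζ : ℂ} {R : ℝ} {v : ConnData} (hR0 : 0 < R)
    (hv : IsVariation X ζ R v) {u : ℂ} (hu : u ∈ X.ends R) (x : ℂ) :
    v.form u x = X.eps u * (radialCoeff ζ v.m * (X.wDeriv u / X.w u * x).re
      + angularCoeff ζ v.m v.m3 * (X.wDeriv u / X.w u * x).im) := by
  have hz := X.z_ne_zero hR0 hu
  have hw : X.w u ≠ 0 := inv_ne_zero hz
  rw [hv.framed u hu, smul_apply, pullback, ContinuousLinearMap.comp_apply,
    X.fderiv_w_apply hu.1 hz, framedModelVar_apply ζ v.m v.m3 hw,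
    smul_eq_mul, div_mul_eq_mul_div]

/-- Coefficients of a `1`-form `ε w^* (l dϱ/ϱ + μ dθ)` wedge another one. -/
theorem wedge_of_polar {η₁ η₂ : OneForm} {u ε q l₁ μ₁ l₂ μ₂ : ℂ} (hε : ε * ε = 1)
    (h₁ : ∀ x, η₁ u x = ε * (l₁ * (q * x).re + μ₁ * (q * x).im))
    (h₂ : ∀ x, η₂ u x = ε * (l₂ * (q * x).re + μ₂ * (q * x).im)) :
    wedge η₁ η₂ u = (l₁ * μ₂ - μ₁ * l₂) * (‖q‖ ^ 2 : ℝ) := by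
  rw [wedge, h₁, h₁, h₂, h₂, ← normSq_eq_norm_sq, normSq_apply]
  simp only [mul_one, mul_re, I_re, mul_zero, I_im, zero_sub, mul_im, add_zero]
  push_cast
  linear_combination (l₁ * μ₂ - μ₁ * l₂) * (q.re * q.re + q.im * q.im) * hε

/-! ## Torus forms -/

/-- The `σ`-invariant forms on the ends. -/
noncomputable def torusModel (c₁ c₂ c₃ : ℂ) : OneForm := fun w =>
  (c₁ / w ^ 3) • dHol + (c₂ / conj w ^ 3) • dAnti + (c₃ / w) • dHol - (c₃ / conj w) • dAnti

theorem torusModel_apply (c₁ c₂ c₃ w y : ℂ) : torusModel c₁ c₂ c₃ w y =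
    c₁ / w ^ 3 * y + c₂ / conj w ^ 3 * conj y + c₃ / w * y - c₃ / conj w * conj y := by
  simp [torusModel, dHol, dAnti]

/-- Under `w ↦ e w̄` the forms `dw/w` and `dw̄/w̄` are exchanged, while `dw/w³` becomes `e⁻²
dw̄/w̄³`; this dictates the relation between `c₁` and `c₂`. The resulting minus sign is compensated
by the sign change of `ε` under the sheet exchange. -/
theorem torusModel_reflect {c₁ c₂ e : ℂ} (he : e * conj e = 1) (hc : c₁ = -(c₂ * e ^ 2)) (c₃ : ℂ)
    {w : ℂ} (hw : w ≠ 0) (y : ℂ) :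
    torusModel c₁ c₂ c₃ (e * conj w) (e * conj y) = -torusModel c₁ c₂ c₃ w y := by
  have he0 : e ≠ 0 := left_ne_zero_of_mul_eq_one he
  have hw' : conj w ≠ 0 := by simpa using hw
  have he' : conj e = e⁻¹ := eq_inv_of_mul_eq_one_right he
  simp only [torusModel_apply, map_mul, conj_conj, he', hc]
  field_simp
  ring

theorem conj_exp_I_mul (ϑ : ℝ) : exp (I * ϑ) * conj (exp (I * ϑ)) = 1 := by
  rw [← exp_conj, ← exp_add]
  simp

/-- A form given on the ends by a reflection-invariant model satisfies the gluing condition. -/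
theorem eq_pullback_sigma (X : SpectralCurve) {ρ : ℝ} (ϑ : ℝ) (hρ : 0 < ρ)
    (hR : 2 * ‖X.m₀‖ * ρ ^ 2 < 1) {β : OneForm} {c₁ c₂ : ℂ} (c₃ : ℂ)
    (hc : c₁ = -(c₂ * exp (I * ϑ) ^ 2))
    (hβ : ∀ u ∈ X.ends ρ, β u = X.eps u • pullback X.w (torusModel c₁ c₂ c₃) u)
    {u : ℂ} (hu : u ∈ X.ends ρ) : β u = pullback (X.sigma ϑ) β u := by
  have he := conj_exp_I_mul ϑ
  set e := exp (I * ϑ) with hedef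
  have hne : ‖e‖ = 1 := by
    rw [hedef, mul_comm]
    exact norm_exp_ofReal_mul_I ϑ
  have hz := X.z_ne_zero hρ hu
  have hw : X.w u ≠ 0 := inv_ne_zero hz
  set w' := e * conj (X.w u) with hw'def
  have hw'n : ‖w'‖ = ‖X.w u‖ := by
    rw [hw'def, norm_mul, hne, one_mul, RCLike.norm_conj]
  have hw' : w' ≠ 0 := by rw [← norm_ne_zero_iff, hw'n]; exact norm_ne_zero_iff.2 hw
  have hwρ : ‖w'‖ < ρ := by
    rw [hw'n, X.norm_w]
    exact (inv_lt_comm₀ (norm_pos_iff.2 hz) hρ).2 hu.2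
  have hwm : 2 * ‖X.m₀‖ * ‖w'‖ ^ 2 < 1 :=
    X.two_mul_norm_m₀_lt (norm_pos_iff.2 hw') hwρ.le hR
  have hε : -X.eps u = 1 ∨ -X.eps u = -1 := by
    rcases X.eps_eq u with h | h <;> simp [h]
  have hσu : X.sigma ϑ u = X.lift (-X.eps u) w' := rfl
  have hσ : X.sigma ϑ u ∈ X.ends ρ := SpectralCurve.lift_mem_ends hε hw' hwm hwρ
  have hep := X.eps_eventuallyEq hu.1 (X.norm_m₀_lt_of_mem_ends hρ hR hu)
  have hdw : DifferentiableAt ℝ X.w u :=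
    (X.contDiffAt_w hu.1 hz).differentiableAt (by simp)
  have hdc : HasFDerivAt (fun v => e * conj (X.w v))
      (e • ((conjCLE : ℂ →L[ℝ] ℂ).comp (fderiv ℝ X.w u))) u :=
    ((conjCLE : ℂ →L[ℝ] ℂ).hasFDerivAt.comp u hdw.hasFDerivAt).const_mul e
  have hdσ : DifferentiableAt ℝ (X.sigma ϑ) u := by
    -- `σ` itself involves `eps`, so differentiating it requires first freezing the sheet near `u`.
    have h1 : X.sigma ϑ =ᶠ[𝓝 u] X.lift (-X.eps u) ∘ fun v => e * conj (X.w v) := by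
      filter_upwards [hep] with v hv
      simp only [SpectralCurve.sigma, hv, Function.comp, hedef]
    refine DifferentiableAt.congr_of_eventuallyEq ?_ h1
    exact (SpectralCurve.differentiableAt_lift hw' hwm).comp u hdc.differentiableAt
  have hcomp : X.w ∘ X.sigma ϑ =ᶠ[𝓝 u] fun v => e * conj (X.w v) := by
    filter_upwards [(X.isOpen_ends ρ).mem_nhds hu] with v hv
    have hz' := X.z_ne_zero hρ hv
    have hn : ‖e * conj (X.w v)‖ = ‖X.w v‖ := by
      rw [norm_mul, hne, one_mul, RCLike.norm_conj]
    have hlt : ‖e * conj (X.w v)‖ < ρ := by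
      rw [hn, X.norm_w]
      exact (inv_lt_comm₀ (norm_pos_iff.2 hz') hρ).2 hv.2
    have h0 : e * conj (X.w v) ≠ 0 := by
      rw [← norm_ne_zero_iff, hn]
      exact norm_ne_zero_iff.2 (inv_ne_zero hz')
    refine SpectralCurve.w_lift ?_ h0 (X.two_mul_norm_m₀_lt (norm_pos_iff.2 h0) hlt.le hR)
    rcases X.eps_eq v with h | h <;> simp [h]
  have hdwσ : DifferentiableAt ℝ X.w (X.sigma ϑ u) :=
    (X.contDiffAt_w hσ.1 (X.z_ne_zero hρ hσ)).differentiableAt (by simp)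
  have hchain : (fderiv ℝ X.w (X.sigma ϑ u)).comp (fderiv ℝ (X.sigma ϑ) u) =
      e • ((conjCLE : ℂ →L[ℝ] ℂ).comp (fderiv ℝ X.w u)) := by
    rw [← fderiv_comp u hdwσ hdσ, hcomp.fderiv_eq, hdc.fderiv]
  have hwσ : X.w (X.sigma ϑ u) = w' := SpectralCurve.w_lift hε hw' hwm
  have hεσ : X.eps (X.sigma ϑ u) = -X.eps u := (SpectralCurve.lift_spec hε hw' hwm).2.2
  ext x
  have hx : fderiv ℝ X.w (X.sigma ϑ u) (fderiv ℝ (X.sigma ϑ) u x) =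
      e * conj (fderiv ℝ X.w u x) := by
    have := congrArg (fun L : ℂ →L[ℝ] ℂ => L x) hchain
    simpa using this
  have h2 : pullback (X.sigma ϑ) β u x = β (X.sigma ϑ u) (fderiv ℝ (X.sigma ϑ) u x) := rfl
  rw [h2, hβ u hu, hβ _ hσ, smul_apply, smul_apply, hεσ, pullback, pullback,
    ContinuousLinearMap.comp_apply, ContinuousLinearMap.comp_apply, hwσ, hx,
    torusModel_reflect he hc c₃ hw]
  simp

/-! ## Gluing families -/

/-- A smooth function on `Σ` that is `0` where `|z|² ≤ t₁` and `1` where `|z|² ≥ t₂`. -/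
noncomputable def endBump (X : SpectralCurve) (t₁ t₂ : ℝ) (u : ℂ) : ℂ :=
  (Real.smoothTransition ((‖X.z u‖ ^ 2 - t₁) / (t₂ - t₁)) : ℝ)

section EndBump

variable {X : SpectralCurve} {t₁ t₂ : ℝ} {u : ℂ}

theorem contDiffAt_endBump (hu : u ≠ 0) : ContDiffAt ℝ ∞ (endBump X t₁ t₂) u := by
  have h1 : ContDiffAt ℝ ∞ (fun v => (‖X.z v‖ ^ 2 - t₁) / (t₂ - t₁)) u :=
    (((X.contDiffAt_z hu).norm_sq ℝ).sub contDiffAt_const).div_const _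
  exact ofRealCLM.contDiff.contDiffAt.comp u (Real.smoothTransition.contDiffAt.comp u h1)

theorem endBump_eq_zero (h : t₁ < t₂) (hu : ‖X.z u‖ ^ 2 ≤ t₁) : endBump X t₁ t₂ u = 0 := by
  rw [endBump, Real.smoothTransition.zero_of_nonpos, ofReal_zero]
  exact div_nonpos_of_nonpos_of_nonneg (by linarith) (by linarith)

theorem endBump_eq_one (h : t₁ < t₂) (hu : t₂ ≤ ‖X.z u‖ ^ 2) : endBump X t₁ t₂ u = 1 := by
  rw [endBump, Real.smoothTransition.one_of_one_le, ofReal_one]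
  rw [le_div_iff₀ (by linarith)]
  linarith

theorem continuousAt_norm_z_sq (hu : u ≠ 0) : ContinuousAt (fun v => ‖X.z v‖ ^ 2) u :=
  ((X.contDiffAt_z hu).norm_sq ℝ).continuousAt

end EndBump

theorem contDiffAt_gluingModel (X : SpectralCurve) (ζ : ℂ) (ϑ : ℝ) (m n : ℂ) {u : ℂ} (hu : u ≠ 0)
    (hz : 2 * ‖X.m₀‖ < ‖X.z u‖ ^ 2) :
    ContDiffAt ℝ ∞ (fun p : ℝ × ℂ => gluingModel X ζ ϑ (m + p.1 * n) p.2) (0, u) := by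
  have hz0 : X.z u ≠ 0 := by
    intro h
    rw [h] at hz
    have := norm_nonneg X.m₀
    simp at hz
    linarith
  have hw0 : X.w u ≠ 0 := inv_ne_zero hz0
  have hs : ContDiffAt ℝ ∞ (fun p : ℝ × ℂ => p.2) (0, u) := contDiffAt_snd
  have hf : ContDiffAt ℝ ∞ (fun p : ℝ × ℂ => (p.1 : ℂ)) (0, u) :=
    ofRealCLM.contDiff.contDiffAt.comp _ contDiffAt_fst
  have hw : ContDiffAt ℝ ∞ (fun p : ℝ × ℂ => X.w p.2) (0, u) :=
    ContDiffAt.comp (g := X.w) ((0 : ℝ), u) (X.contDiffAt_w hu hz0) hs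
  have hwi : ContDiffAt ℝ ∞ (fun p : ℝ × ℂ => (X.w p.2)⁻¹ ^ 2) (0, u) := (hw.inv hw0).pow 2
  have hc : ∀ g : ℝ × ℂ → ℂ, ContDiffAt ℝ ∞ g (0, u) →
      ContDiffAt ℝ ∞ (fun p => conj (g p)) (0, u) := fun g hg =>
    (conjCLE : ℂ →L[ℝ] ℂ).contDiff.contDiffAt.comp _ hg
  have hwc : ContDiffAt ℝ ∞ (fun p : ℝ × ℂ => (conj (X.w p.2))⁻¹ ^ 2) (0, u) :=
    ((hc _ hw).inv (by simpa using hw0)).pow 2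
  have hl : ContDiffAt ℝ ∞ (fun p : ℝ × ℂ => ((Real.log ‖X.w p.2‖ : ℝ) : ℂ)) (0, u) :=
    ContDiffAt.comp ((0 : ℝ), u) (contDiffAt_log_norm hw0) hw
  have hm : ContDiffAt ℝ ∞ (fun p : ℝ × ℂ => m + p.1 * n) (0, u) :=
    contDiffAt_const.add (hf.mul contDiffAt_const)
  have hC : ContDiffAt ℝ ∞ (fun p : ℝ × ℂ => X.eps u / 2 *
      ((ζ⁻¹ + ζ * exp (2 * I * ϑ)) / 2 * (X.w p.2)⁻¹ ^ 2
        + (ζ + ζ⁻¹ * exp (-(2 * I * ϑ))) / 2 * (conj (X.w p.2))⁻¹ ^ 2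
        - 2 * (ζ⁻¹ * (m + p.1 * n) + ζ * conj (m + p.1 * n)) * Real.log ‖X.w p.2‖)) (0, u) :=
    contDiffAt_const.mul (((contDiffAt_const.mul hwi).add (contDiffAt_const.mul hwc)).sub
      ((contDiffAt_const.mul ((contDiffAt_const.mul hm).add
        (contDiffAt_const.mul (hc _ hm)))).mul hl))
  refine hC.congr_of_eventuallyEq ?_
  have he : ∀ᶠ p : ℝ × ℂ in 𝓝 (0, u), X.eps p.2 = X.eps u :=
    hs.continuousAt.eventually (X.eps_eventuallyEq hu hz)
  filter_upwards [he] with p hp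
  simp only [gluingModel, hp]

/-- Gluing families exist. -/
theorem exists_isGluingFamily (X : SpectralCurve) (ζ : ℂ) {ρ R : ℝ} (ϑ : ℝ) (hρ : 0 < ρ)
    (hρR : ρ ≤ R) (hR : 2 * ‖X.m₀‖ * R ^ 2 < 1) :
    ∃ χ : ConnData → ℂ → ℂ, IsGluingFamily X ζ R ρ ϑ χ := by
  have hR0 : 0 < R := hρ.trans_le hρR
  have h2 : 2 * ‖X.m₀‖ < R⁻¹ ^ 2 := by
    have := norm_pos_iff.2 X.m₀_ne
    rw [inv_pow, lt_inv_comm₀ (by positivity) (by positivity), ← one_div,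
      lt_div_iff₀ (by positivity)]
    linarith
  -- The bump rises for `|z|²` between `t` and `R⁻²`. It is `1` on the ends, and wherever it is
  -- nonzero `|z|² > 2 |m₀|`, so the model is smooth there.
  obtain ⟨t, ht1, ht2⟩ := exists_between h2
  refine ⟨fun α u => endBump X t (R⁻¹ ^ 2) u * gluingModel X ζ ϑ α.m u, ?_, ?_⟩
  · intro α v _ _ u hu
    have hb : ContDiffAt ℝ ∞ (fun p : ℝ × ℂ => endBump X t (R⁻¹ ^ 2) p.2) (0, u) :=
      ContDiffAt.comp (g := endBump X t (R⁻¹ ^ 2)) ((0 : ℝ), u) (contDiffAt_endBump hu) contDiffAt_snd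
    rcases lt_or_ge (‖X.z u‖ ^ 2) t with h | h
    · have hs : ContinuousAt (fun p : ℝ × ℂ => p.2) (0, u) := continuous_snd.continuousAt
      have he : ∀ᶠ p : ℝ × ℂ in 𝓝 (0, u), ‖X.z p.2‖ ^ 2 < t :=
        hs.eventually (p := fun y => ‖X.z y‖ ^ 2 < t) ((continuousAt_norm_z_sq hu).eventually_lt continuousAt_const h)
      refine (contDiffAt_const (c := (0 : ℂ))).congr_of_eventuallyEq ?_
      filter_upwards [he] with p hp
      rw [endBump_eq_zero ht2 hp.le, zero_mul]
    · exact hb.mul (contDiffAt_gluingModel X ζ ϑ α.m v.m hu (ht1.trans_le h))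
  · intro α _ u hu
    have h3 : R⁻¹ ^ 2 ≤ ‖X.z u‖ ^ 2 := by
      have := (X.ends_subset hρ hρR hu).2.le
      gcongr
    rw [endBump_eq_one ht2 h3, one_mul]

theorem ConnData.shift_zero (α v : ConnData) : α.shift 0 v = α := by
  have h : (fun u => α.form u + (0 : ℝ) • v.form u) = α.form :=
    funext fun u => (congrArg (α.form u + ·) (zero_smul ℝ (v.form u))).trans (add_zero _)
  simp only [ConnData.shift, ofReal_zero, zero_mul, add_zero, h]

/-- Used to read off smoothness of a single `χ(α)` from the smoothness of families, along the
constant family. -/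
theorem isVariation_zero (X : SpectralCurve) (ζ : ℂ) (R : ℝ) :
    IsVariation X ζ R ⟨0, 0, fun _ => 0⟩ := by
  refine ⟨fun u _ => contDiffAt_const, fun u _ x y => ?_, fun u _ => ?_, ?_, ?_⟩
  · simp
  · ext x
    simp [pullback, framedModelVar]
  · exact Filter.Eventually.of_forall fun _ => rfl
  · exact Filter.Eventually.of_forall fun _ => rfl

/-! ### The glued connection and its variations on the ends -/

section Family

variable {X : SpectralCurve} {ζ : ℂ} {R ρ ϑ : ℝ} {χ : ConnData → ℂ → ℂ} {α v : ConnData} {u : ℂ}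

theorem IsGluingFamily.contDiffAt (hχ : IsGluingFamily X ζ R ρ ϑ χ)
    (hα : IsFramedConnection X ζ R α) (hu : u ≠ 0) : ContDiffAt ℝ ∞ (χ α) u := by
  have h := hχ.smooth α _ hα (isVariation_zero X ζ R) u hu
  have h2 : ContDiffAt ℝ ∞ (fun v : ℂ => ((0 : ℝ), v)) u := contDiffAt_const.prodMk contDiffAt_id
  have h3 := ContDiffAt.comp u h h2
  simpa [Function.comp_def, ConnData.shift_zero] using h3

/-- Near `u` the function `χ̇` is the `τ`-partial derivative, at `τ = 0`, of a function jointly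
smooth in `(τ, u)`. -/
theorem IsGluingFamily.contDiffAt_chiVar (hχ : IsGluingFamily X ζ R ρ ϑ χ)
    (hα : IsFramedConnection X ζ R α) (hv : IsVariation X ζ R v) (hu : u ≠ 0) :
    ContDiffAt ℝ ∞ (chiVar χ α v) u := by
  set f : ℝ × ℂ → ℂ := fun p => χ (α.shift p.1 v) p.2
  have h1 : ContDiffAt ℝ ∞ (fun y : ℂ => fderiv ℝ f (0, y) (1, 0)) u := by
    have h : ContDiffAt ℝ ∞ (fderiv ℝ f) (0, u) :=
      (hχ.smooth α v hα hv u hu).fderiv_right (by simp)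
    have h2 : ContDiffAt ℝ ∞ (fun y : ℂ => ((0 : ℝ), y)) u :=
      contDiffAt_const.prodMk contDiffAt_id
    exact (ContDiffAt.comp u h h2).clm_apply contDiffAt_const
  refine h1.congr_of_eventuallyEq ?_
  filter_upwards [isOpen_ne.mem_nhds hu] with y hy
  have hd : HasFDerivAt f (fderiv ℝ f (0, y)) (0, y) :=
    ((hχ.smooth α v hα hv y hy).differentiableAt (by simp)).hasFDerivAt
  have hc : HasDerivAt (fun τ : ℝ => (τ, y)) ((1 : ℝ), (0 : ℂ)) 0 :=
    (hasDerivAt_id 0).prodMk (hasDerivAt_const _ _)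
  exact (hd.comp_hasDerivAt (0 : ℝ) hc).deriv

theorem IsGluingFamily.chiVar_eq (hχ : IsGluingFamily X ζ R ρ ϑ χ)
    (hα : IsFramedConnection X ζ R α) (hv : IsVariation X ζ R v) (hu : u ∈ X.ends ρ) :
    chiVar χ α v u = X.eps u * radialCoeff ζ v.m * Real.log ‖X.w u‖ := by
  -- The explicit formula is available only while the shifted data remain a framed connection (`m ≠
  -- 0`), hence for small `τ`. It is real-affine in `m`, and only its logarithmic term depends on
  -- `m`.
  have h1 : (fun τ : ℝ => χ (α.shift τ v) u) =ᶠ[𝓝 0] fun τ : ℝ =>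
      gluingModel X ζ ϑ α.m u + (τ : ℂ) * (X.eps u * radialCoeff ζ v.m * Real.log ‖X.w u‖) := by
    filter_upwards [hα.shift hv] with τ hτ
    rw [hχ.formula _ hτ u hu]
    simp only [gluingModel, ConnData.shift, radialCoeff, map_add, map_mul, conj_ofReal]
    ring
  rw [chiVar, h1.deriv_eq]
  have h2 : HasDerivAt (fun τ : ℝ => (τ : ℂ)) 1 0 := ofRealCLM.hasDerivAt
  simpa using ((h2.mul_const (X.eps u * radialCoeff ζ v.m * Real.log ‖X.w u‖)).const_add
    (gluingModel X ζ ϑ α.m u)).deriv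

theorem IsGluingFamily.fderiv_chiVar_apply (hχ : IsGluingFamily X ζ R ρ ϑ χ) (hρ : 0 < ρ)
    (hρm : 2 * ‖X.m₀‖ * ρ ^ 2 < 1) (hα : IsFramedConnection X ζ R α) (hv : IsVariation X ζ R v)
    (hu : u ∈ X.ends ρ) (x : ℂ) :
    fderiv ℝ (chiVar χ α v) u x =
      X.eps u * (radialCoeff ζ v.m * (X.wDeriv u / X.w u * x).re) := by
  have h1 : chiVar χ α v =ᶠ[𝓝 u] fun y => X.eps u * radialCoeff ζ v.m * Real.log ‖X.w y‖ := by
    filter_upwards [(X.isOpen_ends ρ).mem_nhds hu,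
      X.eps_eventuallyEq hu.1 (X.norm_m₀_lt_of_mem_ends hρ hρm hu)] with y hy hy2
    rw [hχ.chiVar_eq hα hv hy, hy2]
  rw [h1.fderiv_eq,
    ((hasFDerivAt_log_norm_w X hu.1 (X.z_ne_zero hρ hu)).const_mul _).fderiv]
  simp [mul_assoc]

/-- The logarithm in `χ` is chosen so that `dχ̇` equals the whole radial part of `α̇`; only the `dθ`
part survives. -/
theorem IsGluingFamily.gluingMapVar_apply (hχ : IsGluingFamily X ζ R ρ ϑ χ) (hρ : 0 < ρ)
    (hρR : ρ ≤ R) (hρm : 2 * ‖X.m₀‖ * ρ ^ 2 < 1) (hα : IsFramedConnection X ζ R α)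
    (hv : IsVariation X ζ R v) (hu : u ∈ X.ends ρ) (x : ℂ) :
    gluingMapVar χ α v u x =
      X.eps u * (angularCoeff ζ v.m v.m3 * (X.wDeriv u / X.w u * x).im) := by
  rw [gluingMapVar, sub_apply, hχ.fderiv_chiVar_apply hρ hρm hα hv hu,
    hv.form_apply (hρ.trans_le hρR) (X.ends_subset hρ hρR hu)]
  ring

theorem ofReal_im_eq (p : ℂ) : (p.im : ℂ) = -I / 2 * (p - conj p) := by
  apply Complex.ext <;> simp
  ring

theorem ofReal_re_eq (p : ℂ) : (p.re : ℂ) = (p + conj p) / 2 := by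
  rw [add_conj]
  simp

/-- The constant comes from `dθ = -(i/2)(dw/w - dw̄/w̄)`. -/
theorem IsGluingFamily.gluingMapVar_eq (hχ : IsGluingFamily X ζ R ρ ϑ χ) (hρ : 0 < ρ)
    (hρR : ρ ≤ R) (hρm : 2 * ‖X.m₀‖ * ρ ^ 2 < 1) (hα : IsFramedConnection X ζ R α)
    (hv : IsVariation X ζ R v) (hu : u ∈ X.ends ρ) :
    gluingMapVar χ α v u =
      X.eps u • pullback X.w (torusModel 0 0 (-I / 2 * angularCoeff ζ v.m v.m3)) u := by
  ext x
  rw [hχ.gluingMapVar_apply hρ hρR hρm hα hv hu, smul_apply, pullback,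
    ContinuousLinearMap.comp_apply, torusModel_apply,
    X.fderiv_w_apply hu.1 (X.z_ne_zero hρ hu), ofReal_im_eq]
  simp only [map_mul, map_div₀, smul_eq_mul]
  ring

theorem fderiv_gluingModel_apply (X : SpectralCurve) (ζ : ℂ) (ϑ : ℝ) (m : ℂ) {ρ : ℝ} (hρ : 0 < ρ)
    (hρm : 2 * ‖X.m₀‖ * ρ ^ 2 < 1) {u : ℂ} (hu : u ∈ X.ends ρ) (x : ℂ) :
    fderiv ℝ (gluingModel X ζ ϑ m) u x = X.eps u / 2 *
      (-((ζ⁻¹ + ζ * exp (2 * I * ϑ)) * (X.wDeriv u * x / X.w u ^ 3))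
        - (ζ + ζ⁻¹ * exp (-(2 * I * ϑ))) * conj (X.wDeriv u * x / X.w u ^ 3)
        - 2 * (ζ⁻¹ * m + ζ * conj m) * (X.wDeriv u / X.w u * x).re) := by
  have hz := X.z_ne_zero hρ hu
  have hw : X.w u ≠ 0 := inv_ne_zero hz
  have h1 : HasDerivAt (fun v => (X.w v)⁻¹ ^ 2) (-2 * (X.wDeriv u / X.w u ^ 3)) u := by
    refine (((X.hasDerivAt_w hu.1 hz).inv hw).pow 2).congr_deriv ?_
    simp
    field_simp
  have h2 := h1.complexToReal_fderiv
  have h3 : HasFDerivAt (fun v => (conj (X.w v))⁻¹ ^ 2) _ u :=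
    (((conjCLE : ℂ →L[ℝ] ℂ).hasFDerivAt.comp u h2).congr_of_eventuallyEq
      (Filter.Eventually.of_forall fun v => by simp))
  have h4 := hasFDerivAt_log_norm_w X hu.1 hz
  have h5 := (((h2.const_mul ((ζ⁻¹ + ζ * exp (2 * I * ϑ)) / 2)).add
    (h3.const_mul ((ζ + ζ⁻¹ * exp (-(2 * I * ϑ))) / 2))).sub
      (h4.const_mul (2 * (ζ⁻¹ * m + ζ * conj m)))).const_mul (X.eps u / 2)
  have h6 : gluingModel X ζ ϑ m =ᶠ[𝓝 u] fun v => X.eps u / 2 *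
      ((ζ⁻¹ + ζ * exp (2 * I * ϑ)) / 2 * (X.w v)⁻¹ ^ 2
        + (ζ + ζ⁻¹ * exp (-(2 * I * ϑ))) / 2 * (conj (X.w v))⁻¹ ^ 2
        - 2 * (ζ⁻¹ * m + ζ * conj m) * Real.log ‖X.w v‖) := by
    filter_upwards [X.eps_eventuallyEq hu.1 (X.norm_m₀_lt_of_mem_ends hρ hρm hu)] with v hv
    simp only [gluingModel, hv]
  have h7 := h6.fderiv_eq.trans (HasFDerivAt.fderiv h5)
  rw [h7]
  simp only [smul_apply, sub_apply, add_apply, ContinuousLinearMap.comp_apply, one_apply_eq_self,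
    smul_eq_mul, ContinuousLinearEquiv.coe_coe, conjCLE_apply, ofRealCLM_apply, reCLM_apply,
    map_mul, map_div₀, map_neg, map_pow, map_ofNat]
  ring

/-- On the ends `dχ(α) = (α - σ^*α)/2`, so the difference is `(α + σ^*α)/2`. This accounts for the
averaged coefficients of the cubic terms and for the opposite coefficients of `dw/w` and `dw̄/w̄`.
-/
theorem IsGluingFamily.gluingMap_eq (hχ : IsGluingFamily X ζ R ρ ϑ χ) (hρ : 0 < ρ)
    (hρR : ρ ≤ R) (hρm : 2 * ‖X.m₀‖ * ρ ^ 2 < 1) (hα : IsFramedConnection X ζ R α)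
    (hu : u ∈ X.ends ρ) :
    gluingMap χ α u = X.eps u • pullback X.w (torusModel ((ζ * exp (I * ϑ) ^ 2 - ζ⁻¹) / 2)
      ((ζ⁻¹ * (exp (I * ϑ) ^ 2)⁻¹ - ζ) / 2) (-(ζ⁻¹ * α.m - ζ * conj α.m - α.m3) / 2)) u := by
  have hw : X.w u ≠ 0 := inv_ne_zero (X.z_ne_zero hρ hu)
  have h1 : χ α =ᶠ[𝓝 u] gluingModel X ζ ϑ α.m := by
    filter_upwards [(X.isOpen_ends ρ).mem_nhds hu] with y hy
    exact hχ.formula α hα y hy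
  have e1 : exp (2 * I * ϑ) = exp (I * ϑ) ^ 2 := by
    rw [← exp_nat_mul]
    push_cast
    ring_nf
  have e2 : exp (-(2 * I * ϑ)) = (exp (I * ϑ) ^ 2)⁻¹ := by rw [exp_neg, e1]
  ext x
  rw [gluingMap, sub_apply, h1.fderiv_eq, fderiv_gluingModel_apply X ζ ϑ α.m hρ hρm hu,
    hα.framed u (X.ends_subset hρ hρR hu), smul_apply, smul_apply, pullback, pullback,
    ContinuousLinearMap.comp_apply, ContinuousLinearMap.comp_apply, torusModel_apply,
    X.fderiv_w_apply hu.1 (X.z_ne_zero hρ hu), ofReal_re_eq, e1, e2]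
  simp only [framedModel, dHol, dAnti, sub_apply, neg_apply, smul_apply, smul_eq_mul,
    ContinuousLinearMap.id_apply, ContinuousLinearEquiv.coe_coe, conjCLE_apply, map_mul, map_div₀,
    map_pow]
  ring

theorem IsGluingFamily.isTorusForm_gluingMap (hχ : IsGluingFamily X ζ R ρ ϑ χ) (hρ : 0 < ρ)
    (hρR : ρ ≤ R) (hρm : 2 * ‖X.m₀‖ * ρ ^ 2 < 1) (hα : IsFramedConnection X ζ R α) (r : ℝ) :
    IsTorusForm X r ρ ϑ {X.b, -X.b} (gluingMap χ α) := by
  have hB : ∀ u ∈ X.cutoff r \ {X.b, -X.b}, u ≠ 0 ∧ u ≠ X.b ∧ u ≠ -X.b := by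
    rintro u ⟨h1, h2⟩
    simp only [mem_insert_iff, mem_singleton_iff, not_or] at h2
    exact ⟨h1.1, h2⟩
  refine ⟨fun u hu => ?_, fun u hu => ?_, fun u hu _ => ?_⟩
  · obtain ⟨h0, h1, h2⟩ := hB u hu
    exact (hα.smooth u h0 h1 h2).sub (contDiffAt_fderiv (hχ.contDiffAt hα h0))
  · obtain ⟨h0, h1, h2⟩ := hB u hu
    exact closedAt_sub (hα.smooth u h0 h1 h2) (contDiffAt_fderiv (hχ.contDiffAt hα h0))
      (hα.closed u h0 h1 h2) (closedAt_fderiv (hχ.contDiffAt hα h0))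
  · refine eq_pullback_sigma X ϑ hρ hρm _ ?_ (fun y hy => hχ.gluingMap_eq hρ hρR hρm hα hy) hu.2
    have := exp_ne_zero (I * ϑ)
    field_simp
    ring

theorem IsGluingFamily.contDiffAt_gluingMapVar (hχ : IsGluingFamily X ζ R ρ ϑ χ)
    (hα : IsFramedConnection X ζ R α) (hv : IsVariation X ζ R v) (hu : u ≠ 0) :
    ContDiffAt ℝ ∞ (gluingMapVar χ α v) u :=
  (hv.smooth u hu).sub (contDiffAt_fderiv (hχ.contDiffAt_chiVar hα hv hu))

theorem IsGluingFamily.isTorusForm_gluingMapVar (hχ : IsGluingFamily X ζ R ρ ϑ χ) (hρ : 0 < ρ)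
    (hρR : ρ ≤ R) (hρm : 2 * ‖X.m₀‖ * ρ ^ 2 < 1) (hα : IsFramedConnection X ζ R α)
    (hv : IsVariation X ζ R v) (r : ℝ) :
    IsTorusForm X r ρ ϑ ∅ (gluingMapVar χ α v) := by
  refine ⟨fun u hu => hχ.contDiffAt_gluingMapVar hα hv hu.1.1, fun u hu => ?_, fun u hu _ => ?_⟩
  · have hc := hχ.contDiffAt_chiVar hα hv hu.1.1
    exact closedAt_sub (hv.smooth u hu.1.1) (contDiffAt_fderiv hc) (hv.closed u hu.1.1)
      (closedAt_fderiv hc)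
  · exact eq_pullback_sigma X ϑ hρ hρm _ (by simp)
      (fun y hy => hχ.gluingMapVar_eq hρ hρR hρm hα hv hy) hu.2

end Family

/-! ## Stokes' theorem on `Σ_r` -/

/-- Stokes' theorem on `Σ_r` for a form which on the ends is
`log |w| (K dθ + N dϱ/ϱ)`. -/
theorem setIntegral_curl_cutoff (X : SpectralCurve) {r ρ : ℝ} (hr : 0 < r) (hrρ : r < ρ)
    (hρm : 2 * ‖X.m₀‖ * ρ ^ 2 < 1) {η : OneForm} {K N : ℂ}
    (hη : ∀ u, u ≠ 0 → ContDiffAt ℝ ∞ η u)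
    (hend : ∀ u ∈ X.ends ρ, ∀ x, η u x = Real.log ‖X.w u‖ *
      (K * (X.wDeriv u / X.w u * x).im + N * (X.wDeriv u / X.w u * x).re))
    (hcurl : ∀ u ∈ X.ends ρ, curl η u = K * (‖X.wDeriv u / X.w u‖ ^ 2 : ℝ)) :
    ∫ u in X.cutoff r, curl η u = -(4 * Real.pi * Real.log r * K) := by
  have hρ : 0 < ρ := hr.trans hrρ
  have hlt : ρ⁻¹ ^ 2 < r⁻¹ ^ 2 := by gcongr
  -- The cutoff `φ` changes strictly inside the annulus `r < |w| < ρ`: it is `1` near and beyond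
  -- `∂Σ_r`, and `0` near the complement of the ends. So `(1 - φ) η` vanishes outside `Σ_r`, and `φ
  -- η` lives on the ends.
  obtain ⟨t₁, ht1, ht1'⟩ := exists_between hlt
  obtain ⟨t₂, ht12, ht2⟩ := exists_between ht1'
  set φ := endBump X t₁ t₂ with hφdef
  have hφ : ∀ u, u ≠ 0 → ContDiffAt ℝ ∞ φ u := fun u hu => contDiffAt_endBump hu
  have hA : ∀ u, u ≠ 0 → ContDiffAt ℝ ∞ (fun v => (1 - φ v) • η v) u := fun u hu =>
    (contDiffAt_const.sub (hφ u hu)).smul (hη u hu)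
  have hB : ∀ u, u ≠ 0 → ContDiffAt ℝ ∞ (fun v => φ v • η v) u := fun u hu =>
    (hφ u hu).smul (hη u hu)
  have hcomp := X.isCompact_cutoff r
  have hint : ∀ β : OneForm, (∀ u, u ≠ 0 → ContDiffAt ℝ ∞ β u) →
      IntegrableOn (curl β) (X.cutoff r) := fun β hβ =>
    ContinuousOn.integrableOn_compact hcomp fun u hu =>
      (continuousAt_curl (hβ u hu.1)).continuousWithinAt
  have hsplit : ∀ u ∈ X.cutoff r, curl η u =
      curl (fun v => (1 - φ v) • η v) u + curl (fun v => φ v • η v) u := by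
    intro u hu
    rw [← curl_add ((hA u hu.1).differentiableAt (by simp))
      ((hB u hu.1).differentiableAt (by simp))]
    congr 1
    ext v x
    simp only [add_apply, smul_apply, smul_eq_mul]
    ring
  have hcm := hcomp.measurableSet
  rw [setIntegral_congr_fun hcm hsplit, integral_add (hint _ hA) (hint _ hB)]
  have hzero : ∫ u in X.cutoff r, curl (fun v => (1 - φ v) • η v) u = 0 := by
    refine setIntegral_curl_eq_zero hcomp isOpen_ne (fun u hu => hu.1)
      (fun u hu => (hA u hu).of_le (by simp)) fun u hu hn => ?_
    have h1 : r⁻¹ < ‖X.z u‖ := by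
      by_contra! h
      exact hn ⟨hu, h⟩
    have h2 : t₂ ≤ ‖X.z u‖ ^ 2 := by
      have : r⁻¹ ^ 2 ≤ ‖X.z u‖ ^ 2 := by gcongr
      linarith
    rw [hφdef, endBump_eq_one ht12 h2, sub_self]
    exact zero_smul ℂ (η u)
  rw [hzero, zero_add]
  -- the contribution of the ends
  let H : ℝ → ℝ := fun s => Real.smoothTransition ((Real.exp (-2 * s) - t₁) / (t₂ - t₁))
  have hH : ContDiff ℝ ∞ H := by
    refine Real.smoothTransition.contDiff.comp ?_
    exact ((Real.contDiff_exp.comp (contDiff_const.mul contDiff_id)).sub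
      contDiff_const).div_const _
  have hHd : ∀ s, HasDerivAt H (deriv H s) s := fun s =>
    (hH.differentiable (by simp) s).hasDerivAt
  have hHc : Continuous (deriv H) := hH.continuous_deriv (by simp)
  have hexp : ∀ y : ℝ, 0 < y → Real.exp (-2 * Real.log y) = y⁻¹ ^ 2 := by
    intro y hy
    rw [show -2 * Real.log y = (2 : ℕ) * -Real.log y by push_cast; ring, Real.exp_nat_mul,
      Real.exp_neg, Real.exp_log hy]
  have hHr : H (Real.log r) = 1 := by
    refine Real.smoothTransition.one_of_one_le ?_
    rw [hexp r hr, le_div_iff₀ (by linarith)]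
    linarith
  have hHρ : H (Real.log ρ) = 0 := by
    refine Real.smoothTransition.zero_of_nonpos ?_
    rw [hexp ρ hρ]
    exact div_nonpos_of_nonpos_of_nonneg (by linarith) (by linarith)
  -- Chosen so that `d(φη)` has coefficient `F |w|` in the coordinate `w`, the `N` term being closed
  -- and radial. Then `y F(y)` is the derivative of `K log y · H(log y)`, whose value is `K log r`
  -- at `r` and `0` at `ρ`.
  let F : ℝ → ℂ := fun y =>
    K * (((H (Real.log y) + Real.log y * deriv H (Real.log y)) / y ^ 2 : ℝ) : ℂ)
  have hF : ∫ y in r..ρ, y * F y = -(Real.log r * K) := by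
    have hne : ∀ y ∈ uIcc r ρ, y ≠ 0 := by
      intro y hy
      rw [uIcc_of_le hrρ.le] at hy
      exact (hr.trans_le hy.1).ne'
    have h1 : ∀ y ∈ uIcc r ρ, HasDerivAt (fun y => Real.log y * H (Real.log y))
        ((H (Real.log y) + Real.log y * deriv H (Real.log y)) / y) y := by
      intro y hy
      have hl := Real.hasDerivAt_log (hne y hy)
      refine (hl.mul ((hHd _).comp y hl)).congr_deriv ?_
      simp only [Function.comp]
      field_simp
    have hcont : ContinuousOn
        (fun y => (H (Real.log y) + Real.log y * deriv H (Real.log y)) / y) (uIcc r ρ) := by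
      have hl : ContinuousOn Real.log (uIcc r ρ) := Real.continuousOn_log.mono hne
      exact ((hH.continuous.comp_continuousOn hl).add
        (hl.mul (hHc.comp_continuousOn hl))).div continuousOn_id hne
    have h2 := intervalIntegral.integral_eq_sub_of_hasDerivAt h1 hcont.intervalIntegrable
    have h3 : ∀ y ∈ uIcc r ρ, (y : ℂ) * F y =
        K * (((H (Real.log y) + Real.log y * deriv H (Real.log y)) / y : ℝ) : ℂ) := by
      intro y hy
      have hy0 : (y : ℂ) ≠ 0 := ofReal_ne_zero.2 (hne y hy)
      simp only [F]
      push_cast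
      field_simp
    rw [intervalIntegral.integral_congr h3, intervalIntegral.integral_const_mul,
      intervalIntegral.integral_ofReal, h2, hHr, hHρ]
    push_cast
    ring
  have hendcurl : ∀ u ∈ X.ends ρ, curl (fun v => φ v • η v) u =
      (‖X.wDeriv u‖ ^ 2 : ℝ) * F ‖X.w u‖ := by
    intro u hu
    have hz := X.z_ne_zero hρ hu
    have hw : X.w u ≠ 0 := inv_ne_zero hz
    have h1 : φ =ᶠ[𝓝 u] fun v => ((H (Real.log ‖X.w v‖) : ℝ) : ℂ) := by
      filter_upwards [(X.isOpen_ends ρ).mem_nhds hu] with v hv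
      have hv0 := norm_pos_iff.2 (X.w_ne_zero hρ hv)
      simp only [hφdef, endBump, H, hexp _ hv0]
      rw [X.norm_w, inv_inv]
    have h2 : HasFDerivAt (fun v => ((H (Real.log ‖X.w v‖) : ℝ) : ℂ))
        (ofRealCLM.comp ((deriv H (Real.log ‖X.w u‖)) •
          (reCLM.comp ((X.w u)⁻¹ • (1 : ℂ →L[ℝ] ℂ))).comp (X.wDeriv u • (1 : ℂ →L[ℝ] ℂ)))) u :=
      ofRealCLM.hasFDerivAt.comp u ((hHd _).comp_hasFDerivAt u
        ((hasFDerivAt_log_norm hw).comp u (X.hasDerivAt_w hu.1 hz).complexToReal_fderiv))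
    have h3 : ∀ x, fderiv ℝ φ u x =
        1 * (deriv H (Real.log ‖X.w u‖) * (X.wDeriv u / X.w u * x).re +
          0 * (X.wDeriv u / X.w u * x).im) := by
      intro x
      rw [h1.fderiv_eq, h2.fderiv]
      simp only [ContinuousLinearMap.comp_apply, smul_apply, ofRealCLM_apply, reCLM_apply,
        one_apply_eq_self, smul_eq_mul, ofReal_mul, zero_mul, add_zero, one_mul,
        div_eq_inv_mul, mul_assoc]
    have h4 : ∀ x, η u x = 1 * (Real.log ‖X.w u‖ * N * (X.wDeriv u / X.w u * x).re +
          Real.log ‖X.w u‖ * K * (X.wDeriv u / X.w u * x).im) := by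
      intro x
      rw [hend u hu x]
      ring
    rw [curl_smul ((hφ u hu.1).differentiableAt (by simp))
      ((hη u hu.1).differentiableAt (by simp)), hcurl u hu,
      wedge_of_polar (one_mul 1) h3 h4, h1.eq_of_nhds, norm_div]
    have hn : ((‖X.w u‖ : ℝ) : ℂ) ≠ 0 := ofReal_ne_zero.2 (norm_ne_zero_iff.2 hw)
    simp only [F]
    push_cast
    field_simp
    ring
  have hmeas : ∀ ε : ℂ, MeasurableSet (X.cutoff r ∩ (X.ends ρ ∩ {u | X.eps u = ε})) := fun ε =>
    hcm.inter ((X.isOpen_ends ρ).measurableSet.inter (X.measurableSet_eps_eq ε))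
  have hpiece : ∀ ε : ℂ, ε = 1 ∨ ε = -1 →
      ∫ u in X.cutoff r ∩ (X.ends ρ ∩ {u | X.eps u = ε}), curl (fun v => φ v • η v) u =
        2 * Real.pi * -(Real.log r * K) := by
    intro ε hε
    rw [setIntegral_congr_fun (hmeas ε) (fun u hu => hendcurl u hu.2.1),
      setIntegral_end X F hε hr hrρ.le hρm, hF]
  have hunion : (X.cutoff r ∩ (X.ends ρ ∩ {u | X.eps u = 1})) ∪
      (X.cutoff r ∩ (X.ends ρ ∩ {u | X.eps u = -1})) = X.cutoff r ∩ X.ends ρ := by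
    ext u
    have := X.eps_eq u
    simp only [mem_union, mem_inter_iff, mem_ofPred_eq]
    tauto
  have hdisj : Disjoint (X.cutoff r ∩ (X.ends ρ ∩ {u | X.eps u = 1}))
      (X.cutoff r ∩ (X.ends ρ ∩ {u | X.eps u = -1})) := by
    rw [Set.disjoint_left]
    rintro u ⟨-, -, h1⟩ ⟨-, -, h2⟩
    have h1' : X.eps u = 1 := h1
    have h2' : X.eps u = -1 := h2
    rw [h1'] at h2'
    norm_num at h2'
  have hvanish : ∀ u ∈ X.cutoff r \ (X.cutoff r ∩ X.ends ρ), curl (fun v => φ v • η v) u = 0 := by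
    rintro u ⟨hu, hn⟩
    have h1 : ‖X.z u‖ ≤ ρ⁻¹ := by
      by_contra! h
      exact hn ⟨hu, hu.1, h⟩
    have h2 : ‖X.z u‖ ^ 2 < t₁ := by
      have : ‖X.z u‖ ^ 2 ≤ ρ⁻¹ ^ 2 := by gcongr
      linarith
    have h3 : (fun v => φ v • η v) =ᶠ[𝓝 u] fun _ => 0 := by
      filter_upwards [(continuousAt_norm_z_sq hu.1).eventually_lt continuousAt_const h2] with v hv
      rw [hφdef, endBump_eq_zero ht12 hv.le]
      exact zero_smul ℂ (η v)
    simp [curl, h3.fderiv_eq]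
  rw [setIntegral_eq_of_subset_of_forall_sdiff_eq_zero hcm inter_subset_left hvanish, ← hunion,
    setIntegral_union hdisj (hmeas _) ((hint _ hB).mono_set inter_subset_left)
      ((hint _ hB).mono_set inter_subset_left), hpiece 1 (Or.inl rfl), hpiece (-1) (Or.inr rfl)]
  ring

/-! ## Curves and polar coordinates on the ends -/

section Polar

variable {X : SpectralCurve} {ε w : ℂ}

/-- `w^*` inverts the pullback along `lift`. -/
theorem wDeriv_mul_fderiv_lift (hε : ε = 1 ∨ ε = -1) (hw0 : w ≠ 0)
    (hw : 2 * ‖X.m₀‖ * ‖w‖ ^ 2 < 1) (y : ℂ) :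
    X.wDeriv (X.lift ε w) / X.w (X.lift ε w) * fderiv ℝ (X.lift ε) w y = y / w := by
  obtain ⟨h0, hz, -⟩ := SpectralCurve.lift_spec (X := X) hε hw0 hw
  have hz0 : X.z (X.lift ε w) ≠ 0 := by
    rw [hz]
    exact inv_ne_zero hw0
  have hd := SpectralCurve.differentiableAt_lift (X := X) (ε := ε) hw0 hw
  have hc : X.w ∘ X.lift ε =ᶠ[𝓝 w] id := by
    have hcont : Continuous fun v : ℂ => 2 * ‖X.m₀‖ * ‖v‖ ^ 2 := by fun_prop
    filter_upwards [isOpen_ne.mem_nhds hw0,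
      hcont.continuousAt.eventually_lt continuousAt_const hw] with v hv hv'
    exact SpectralCurve.w_lift hε hv hv'
  have h1 : fderiv ℝ X.w (X.lift ε w) (fderiv ℝ (X.lift ε) w y) = y := by
    have h2 := fderiv_comp w ((X.contDiffAt_w h0 hz0).differentiableAt (by simp)) hd
    rw [hc.fderiv_eq, fderiv_id] at h2
    exact (congrArg (fun L : ℂ →L[ℝ] ℂ => L y) h2).symm
  rw [X.fderiv_w_apply h0 hz0] at h1
  rw [div_mul_eq_mul_div, h1, SpectralCurve.w_lift hε hw0 hw]

/-- The framed form is exact on `0 < |w| < R`, so the `O(ϱ)` errors vanish identically near the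
puncture. -/
theorem IsVariation.hasPolarCoeffs {ζ : ℂ} {R : ℝ} {v : ConnData} (hR0 : 0 < R)
    (hR : 2 * ‖X.m₀‖ * R ^ 2 < 1) (hv : IsVariation X ζ R v) :
    HasPolarCoeffs X v (angularCoeff ζ v.m v.m3) (radialCoeff ζ v.m) := by
  intro ε hε
  have hsmall : ∀ᶠ w : ℂ in 𝓝[≠] 0, w ≠ 0 ∧ ‖w‖ < R := by
    refine Filter.Eventually.and self_mem_nhdsWithin (nhdsWithin_le_nhds ?_)
    filter_upwards [Metric.ball_mem_nhds (0 : ℂ) hR0] with w hw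
    simpa using hw
  have key : ∀ w : ℂ, w ≠ 0 ∧ ‖w‖ < R → ∀ y, pullback (X.lift ε) v.form w y =
      ε * (radialCoeff ζ v.m * (y / w).re + angularCoeff ζ v.m v.m3 * (y / w).im) := by
    rintro w ⟨hw0, hw⟩ y
    have hw' : 2 * ‖X.m₀‖ * ‖w‖ ^ 2 < 1 :=
      X.two_mul_norm_m₀_lt (norm_pos_iff.2 hw0) hw.le hR
    rw [pullback, ContinuousLinearMap.comp_apply,
      hv.form_apply hR0 (SpectralCurve.lift_mem_ends hε hw0 hw' hw),
      wDeriv_mul_fderiv_lift hε hw0 hw', (SpectralCurve.lift_spec hε hw0 hw').2.2]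
  constructor
  · refine Filter.EventuallyEq.trans_isBigO ?_ (Asymptotics.isBigO_zero _ _)
    filter_upwards [hsmall] with w hw
    rw [key w hw, mul_div_cancel_right₀ _ hw.1]
    simp
  · refine Filter.EventuallyEq.trans_isBigO ?_ (Asymptotics.isBigO_zero _ _)
    filter_upwards [hsmall] with w hw
    rw [key w hw, div_self hw.1]
    simp

/-- Two candidate constants differ by a constant that is `O(w)`, hence by zero. This makes the
regularization term independent of the chosen coefficients. -/
theorem HasPolarCoeffs.unique {v : ConnData} {μ l μ' l' : ℂ} (h : HasPolarCoeffs X v μ l)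
    (h' : HasPolarCoeffs X v μ' l') : μ = μ' ∧ l = l' := by
  have key : ∀ (f : ℂ → ℂ) (a b : ℂ), (fun w => f w - 1 * a) =O[𝓝[≠] 0] (fun w : ℂ => w) →
      (fun w => f w - 1 * b) =O[𝓝[≠] 0] (fun w : ℂ => w) → a = b := by
    intro f a b ha hb
    have ht : Filter.Tendsto (fun w : ℂ => w) (𝓝[≠] 0) (𝓝 0) :=
      Filter.tendsto_id.mono_left nhdsWithin_le_nhds
    have h1 := (hb.sub ha).trans_tendsto ht
    have h2 : (fun w : ℂ => f w - 1 * b - (f w - 1 * a)) = fun _ => a - b := by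
      ext w
      ring
    rw [h2] at h1
    exact sub_eq_zero.1 (tendsto_nhds_unique tendsto_const_nhds h1)
  exact ⟨key _ _ _ (h 1 (Or.inl rfl)).1 (h' 1 (Or.inl rfl)).1,
    key _ _ _ (h 1 (Or.inl rfl)).2 (h' 1 (Or.inl rfl)).2⟩

/-- The boundary integral of `log |w| (K dθ + N dϱ/ϱ)`. -/
theorem boundaryIntegral_log {r ρ : ℝ} (hr : 0 < r) (hrρ : r < ρ)
    (hρm : 2 * ‖X.m₀‖ * ρ ^ 2 < 1) {η : OneForm} {K N : ℂ}
    (hend : ∀ u ∈ X.ends ρ, ∀ x, η u x = Real.log ‖X.w u‖ *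
      (K * (X.wDeriv u / X.w u * x).im + N * (X.wDeriv u / X.w u * x).re)) :
    boundaryIntegral X r η = -(4 * Real.pi * Real.log r * K) := by
  have key : ∀ ε : ℂ, ε = 1 ∨ ε = -1 →
      loopIntegral (fun θ => X.lift ε (r * exp (-(θ * I)))) η =
        -(2 * Real.pi * Real.log r * K) := by
    intro ε hε
    have h1 : ∀ θ : ℝ, η (X.lift ε (r * exp (-(θ * I))))
        (deriv (fun θ : ℝ => X.lift ε (r * exp (-(θ * I)))) θ) = -(Real.log r * K) := by
      intro θ
      have hn : ‖(r : ℂ) * exp (-(θ * I))‖ = r := by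
        rw [norm_mul, ← neg_mul, ← ofReal_neg, norm_exp_ofReal_mul_I, mul_one, norm_real,
          Real.norm_of_nonneg hr.le]
      have hc : HasDerivAt (fun θ : ℝ => (r : ℂ) * exp (-(θ * I)))
          (-I * (r * exp (-(θ * I)))) θ := by
        have h2 : HasDerivAt (fun θ : ℝ => -((θ : ℂ) * I)) (-(1 * I)) θ :=
          ((ofRealCLM.hasDerivAt (x := θ)).mul_const I).neg
        refine (h2.cexp.const_mul (r : ℂ)).congr_deriv ?_
        ring
      set w : ℂ := r * exp (-(θ * I))
      have hw0 : w ≠ 0 := by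
        rw [← norm_ne_zero_iff, hn]
        exact hr.ne'
      have hwρ : ‖w‖ < ρ := by rwa [hn]
      have hw : 2 * ‖X.m₀‖ * ‖w‖ ^ 2 < 1 :=
        X.two_mul_norm_m₀_lt (norm_pos_iff.2 hw0) hwρ.le hρm
      -- The clockwise velocity is `-i w`, on which `dθ` takes the value `-1` and `dϱ` the value
      -- `0`; hence `N` drops out.
      have hd : HasDerivAt (fun θ : ℝ => X.lift ε (r * exp (-(θ * I))))
          (fderiv ℝ (X.lift ε) w (-I * w)) θ :=
        HasFDerivAt.comp_hasDerivAt (l := X.lift ε) θ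
          (SpectralCurve.differentiableAt_lift hw0 hw).hasFDerivAt hc
      rw [hd.deriv, hend _ (SpectralCurve.lift_mem_ends hε hw0 hw hwρ),
        wDeriv_mul_fderiv_lift hε hw0 hw, SpectralCurve.w_lift hε hw0 hw, hn,
        mul_div_cancel_right₀ _ hw0]
      simp
    rw [loopIntegral, intervalIntegral.integral_congr (fun θ _ => h1 θ)]
    simp
    ring
  rw [boundaryIntegral, key 1 (Or.inl rfl), key (-1) (Or.inr rfl)]
  ring

end Polar

/-! ## The comparison of the two forms -/

section Comparison

variable {X : SpectralCurve} {ζ : ℂ} {R ρ r r' ϑ : ℝ} {χ : ConnData → ℂ → ℂ} {α v₁ v₂ : ConnData}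
  {u : ℂ}

/-- Both factors of every term carry `ε`, and `ε² = 1`, so the expression is the same on the two
ends. The radial parts of the first two terms cancel, leaving the one from `χ̇₁ dχ̇₂`. -/
theorem IsGluingFamily.primitive_apply (hχ : IsGluingFamily X ζ R ρ ϑ χ) (hρ : 0 < ρ)
    (hρR : ρ ≤ R) (hρm : 2 * ‖X.m₀‖ * ρ ^ 2 < 1) (hα : IsFramedConnection X ζ R α)
    (hv₁ : IsVariation X ζ R v₁) (hv₂ : IsVariation X ζ R v₂) (hu : u ∈ X.ends ρ) (x : ℂ) :
    (chiVar χ α v₂ u • v₁.form u - chiVar χ α v₁ u • v₂.form u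
        + chiVar χ α v₁ u • fderiv ℝ (chiVar χ α v₂) u) x =
      Real.log ‖X.w u‖ *
        ((angularCoeff ζ v₁.m v₁.m3 * radialCoeff ζ v₂.m
            - angularCoeff ζ v₂.m v₂.m3 * radialCoeff ζ v₁.m) * (X.wDeriv u / X.w u * x).im
          + radialCoeff ζ v₁.m * radialCoeff ζ v₂.m * (X.wDeriv u / X.w u * x).re) := by
  have hR0 := hρ.trans_le hρR
  have hu' := X.ends_subset hρ hρR hu
  simp only [add_apply, sub_apply, smul_apply, smul_eq_mul]
  rw [hv₁.form_apply hR0 hu', hv₂.form_apply hR0 hu', hχ.fderiv_chiVar_apply hρ hρm hα hv₂ hu,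
    hχ.chiVar_eq hα hv₁ hu, hχ.chiVar_eq hα hv₂ hu]
  linear_combination (Real.log ‖X.w u‖ *
        ((angularCoeff ζ v₁.m v₁.m3 * radialCoeff ζ v₂.m
            - angularCoeff ζ v₂.m v₂.m3 * radialCoeff ζ v₁.m) * (X.wDeriv u / X.w u * x).im
          + radialCoeff ζ v₁.m * radialCoeff ζ v₂.m * (X.wDeriv u / X.w u * x).re)) *
    X.eps_mul_self u

theorem IsGluingFamily.wedge_gluingMapVar_eq_zero (hχ : IsGluingFamily X ζ R ρ ϑ χ) (hρ : 0 < ρ)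
    (hρR : ρ ≤ R) (hρm : 2 * ‖X.m₀‖ * ρ ^ 2 < 1) (hα : IsFramedConnection X ζ R α)
    (hv₁ : IsVariation X ζ R v₁) (hv₂ : IsVariation X ζ R v₂) (hu : u ∈ X.ends ρ) :
    wedge (gluingMapVar χ α v₁) (gluingMapVar χ α v₂) u = 0 := by
  simp only [wedge, hχ.gluingMapVar_apply hρ hρR hρm hα hv₁ hu,
    hχ.gluingMapVar_apply hρ hρR hρm hα hv₂ hu]
  ring

/-- The glued form does not depend on where the ends are cut. -/
theorem IsGluingFamily.gluedForm_eq (hχ : IsGluingFamily X ζ R ρ ϑ χ) (hρR : ρ ≤ R)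
    (hρm : 2 * ‖X.m₀‖ * ρ ^ 2 < 1) (hα : IsFramedConnection X ζ R α)
    (hv₁ : IsVariation X ζ R v₁) (hv₂ : IsVariation X ζ R v₂) (hr' : 0 < r') (hr'r : r' ≤ r)
    (hrρ : r < ρ) : gluedForm X r χ α v₁ v₂ = gluedForm X r' χ α v₁ v₂ := by
  have hsub : X.cutoff r ⊆ X.cutoff r' := fun u hu =>
    ⟨hu.1, hu.2.trans (by gcongr)⟩
  refine (setIntegral_eq_of_subset_of_forall_sdiff_eq_zero
    (X.isCompact_cutoff r').measurableSet hsub ?_).symm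
  rintro u ⟨h1, h2⟩
  have h3 : r⁻¹ < ‖X.z u‖ := by
    by_contra! h
    exact h2 ⟨h1.1, h⟩
  have hr : 0 < r := hr'.trans_le hr'r
  have hu : u ∈ X.ends ρ := ⟨h1.1, (by gcongr : ρ⁻¹ < r⁻¹).trans h3⟩
  exact hχ.wedge_gluingMapVar_eq_zero (hr.trans hrρ) hρR hρm hα hv₁ hv₂ hu

theorem IsGluingFamily.boundaryTerm_eq (hχ : IsGluingFamily X ζ R ρ ϑ χ) (hr : 0 < r)
    (hrρ : r < ρ) (hρR : ρ ≤ R) (hρm : 2 * ‖X.m₀‖ * ρ ^ 2 < 1) (hα : IsFramedConnection X ζ R α)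
    (hv₁ : IsVariation X ζ R v₁) (hv₂ : IsVariation X ζ R v₂) :
    boundaryTerm X r χ α v₁ v₂ = -(2 * Real.pi * Real.log r) *
      regCoeff (angularCoeff ζ v₁.m v₁.m3) (radialCoeff ζ v₁.m)
        (angularCoeff ζ v₂.m v₂.m3) (radialCoeff ζ v₂.m) := by
  rw [boundaryTerm, boundaryIntegral_log hr hrρ hρm fun u hu x =>
    hχ.primitive_apply (hr.trans hrρ) hρR hρm hα hv₁ hv₂ hu x, regCoeff]
  ring

/-- The boundary formula for the glued form. -/
theorem IsGluingFamily.gluedForm_eq_add (hχ : IsGluingFamily X ζ R ρ ϑ χ) (hr : 0 < r)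
    (hrρ : r < ρ) (hρR : ρ ≤ R) (hρm : 2 * ‖X.m₀‖ * ρ ^ 2 < 1) (hα : IsFramedConnection X ζ R α)
    (hv₁ : IsVariation X ζ R v₁) (hv₂ : IsVariation X ζ R v₂) :
    gluedForm X r χ α v₁ v₂ =
      wedgeIntegral (X.cutoff r) v₁.form v₂.form + boundaryTerm X r χ α v₁ v₂ := by
  have hρ : 0 < ρ := hr.trans hrρ
  have hcomp := X.isCompact_cutoff r
  have hint : ∀ β₁ β₂ : OneForm, (∀ u, u ≠ 0 → ContDiffAt ℝ ∞ β₁ u) →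
      (∀ u, u ≠ 0 → ContDiffAt ℝ ∞ β₂ u) → IntegrableOn (wedge β₁ β₂) (X.cutoff r) :=
    fun β₁ β₂ h₁ h₂ => ContinuousOn.integrableOn_compact hcomp fun u hu =>
      (continuousAt_wedge (h₁ u hu.1) (h₂ u hu.1)).continuousWithinAt
  have hc₁ : ∀ u, u ≠ 0 → ContDiffAt ℝ ∞ (chiVar χ α v₁) u := fun u hu =>
    hχ.contDiffAt_chiVar hα hv₁ hu
  have hc₂ : ∀ u, u ≠ 0 → ContDiffAt ℝ ∞ (chiVar χ α v₂) u := fun u hu =>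
    hχ.contDiffAt_chiVar hα hv₂ hu
  have hdiff : ∀ u, u ≠ 0 → wedge (gluingMapVar χ α v₁) (gluingMapVar χ α v₂) u -
      wedge v₁.form v₂.form u = curl (fun u => chiVar χ α v₂ u • v₁.form u
        - chiVar χ α v₁ u • v₂.form u + chiVar χ α v₁ u • fderiv ℝ (chiVar χ α v₂) u) u :=
    fun u hu => wedge_sub_fderiv (hv₁.smooth u hu) (hv₂.smooth u hu) (hv₁.closed u hu)
      (hv₂.closed u hu) (hc₁ u hu) (hc₂ u hu)
  have hstokes := setIntegral_curl_cutoff X hr hrρ hρm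
    (η := fun u => chiVar χ α v₂ u • v₁.form u
        - chiVar χ α v₁ u • v₂.form u + chiVar χ α v₁ u • fderiv ℝ (chiVar χ α v₂) u)
    (fun u hu => (((hc₂ u hu).smul (hv₁.smooth u hu)).sub
      ((hc₁ u hu).smul (hv₂.smooth u hu))).add
        ((hc₁ u hu).smul (contDiffAt_fderiv (hc₂ u hu))))
    (fun u hu x => hχ.primitive_apply hρ hρR hρm hα hv₁ hv₂ hu x)
    -- The exterior derivative of the primitive need not be computed: on the ends the glued wedge is
    -- zero, so it equals `-α̇₁ ∧ α̇₂`.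
    (fun u hu => by
      have hu' := X.ends_subset hρ hρR hu
      have hR0 := hρ.trans_le hρR
      rw [← hdiff u hu.1, hχ.wedge_gluingMapVar_eq_zero hρ hρR hρm hα hv₁ hv₂ hu,
        wedge_of_polar (X.eps_mul_self u) (hv₁.form_apply hR0 hu') (hv₂.form_apply hR0 hu')]
      ring)
  rw [← setIntegral_congr_fun hcomp.measurableSet (fun u hu => hdiff u hu.1),
    integral_sub
      (hint _ _ (fun u hu => hχ.contDiffAt_gluingMapVar hα hv₁ hu)
        (fun u hu => hχ.contDiffAt_gluingMapVar hα hv₂ hu))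
      (hint _ _ hv₁.smooth hv₂.smooth)] at hstokes
  have h1 : gluedForm X r χ α v₁ v₂ - wedgeIntegral (X.cutoff r) v₁.form v₂.form = _ := hstokes
  rw [hχ.boundaryTerm_eq hr hrρ hρR hρm hα hv₁ hv₂, ← sub_eq_iff_eq_add', h1, regCoeff]
  ring

theorem IsGluingFamily.hasRegularizedValue (hχ : IsGluingFamily X ζ R ρ ϑ χ) (hr : 0 < r)
    (hrρ : r < ρ) (hρR : ρ ≤ R) (hR : 2 * ‖X.m₀‖ * R ^ 2 < 1) (hα : IsFramedConnection X ζ R α)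
    (hv₁ : IsVariation X ζ R v₁) (hv₂ : IsVariation X ζ R v₂) :
    HasRegularizedValue X v₁ v₂ (gluedForm X r χ α v₁ v₂) := by
  have hρ : 0 < ρ := hr.trans hrρ
  have hρm := X.two_mul_norm_m₀_lt hρ hρR hR
  have hR0 := hρ.trans_le hρR
  refine ⟨_, _, _, _, hv₁.hasPolarCoeffs hR0 hR, hv₂.hasPolarCoeffs hR0 hR, ?_⟩
  -- For every cut radius `r' ≤ r` the regularized bracket already equals the glued form at `r`, so
  -- the limit is that of a constant.
  refine tendsto_const_nhds.congr' ?_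
  filter_upwards [Ioc_mem_nhdsGT hr] with r' hr'
  rw [hχ.gluedForm_eq hρR hρm hα hv₁ hv₂ hr'.1 hr'.2 hrρ,
    hχ.gluedForm_eq_add hr'.1 (hr'.2.trans_lt hrρ) hρR hρm hα hv₁ hv₂,
    hχ.boundaryTerm_eq hr'.1 (hr'.2.trans_lt hrρ) hρR hρm hα hv₁ hv₂]
  ring

end Comparison

end SpectralGluing

theorem mainTheorem7 (X : SpectralGluing.SpectralCurve) (ζ : ℂ) (hζ : ζ ≠ 0)
    (r ρ R ϑ : ℝ) (hr : 0 < r) (hrρ : r < ρ) (hρR : ρ ≤ R) (hR : 2 * ‖X.m₀‖ * R ^ 2 < 1) :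
    (∃ χ : SpectralGluing.ConnData → ℂ → ℂ, SpectralGluing.IsGluingFamily X ζ R ρ ϑ χ) ∧
    ∀ χ : SpectralGluing.ConnData → ℂ → ℂ, SpectralGluing.IsGluingFamily X ζ R ρ ϑ χ →
    ∀ α : SpectralGluing.ConnData, SpectralGluing.IsFramedConnection X ζ R α →
      SpectralGluing.IsTorusForm X r ρ ϑ {X.b, -X.b} (SpectralGluing.gluingMap χ α) ∧
      (∀ v : SpectralGluing.ConnData, SpectralGluing.IsVariation X ζ R v →
        SpectralGluing.IsTorusForm X r ρ ϑ ∅ (SpectralGluing.gluingMapVar χ α v)) ∧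
      ∀ v₁ v₂ : SpectralGluing.ConnData,
        SpectralGluing.IsVariation X ζ R v₁ → SpectralGluing.IsVariation X ζ R v₂ →
        SpectralGluing.HasRegularizedValue X v₁ v₂
          (SpectralGluing.gluedForm X r χ α v₁ v₂) ∧
        SpectralGluing.gluedForm X r χ α v₁ v₂ =
          SpectralGluing.wedgeIntegral (X.cutoff r) v₁.form v₂.form
            + SpectralGluing.boundaryTerm X r χ α v₁ v₂ ∧
        ∀ μ₁ l₁ μ₂ l₂ : ℂ, SpectralGluing.HasPolarCoeffs X v₁ μ₁ l₁ →
          SpectralGluing.HasPolarCoeffs X v₂ μ₂ l₂ →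
          SpectralGluing.boundaryTerm X r χ α v₁ v₂ =
            -(2 * Real.pi * Real.log r) * SpectralGluing.regCoeff μ₁ l₁ μ₂ l₂ := by
  have hρ : 0 < ρ := hr.trans hrρ
  have hρm := X.two_mul_norm_m₀_lt hρ hρR hR
  have hR0 := hρ.trans_le hρR
  refine ⟨SpectralGluing.exists_isGluingFamily X ζ ϑ hρ hρR hR, fun χ hχ α hα => ?_⟩
  refine ⟨hχ.isTorusForm_gluingMap hρ hρR hρm hα r,
    fun v hv => hχ.isTorusForm_gluingMapVar hρ hρR hρm hα hv r, fun v₁ v₂ hv₁ hv₂ => ?_⟩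
  refine ⟨hχ.hasRegularizedValue hr hrρ hρR hR hα hv₁ hv₂,
    hχ.gluedForm_eq_add hr hrρ hρR hρm hα hv₁ hv₂, fun μ₁ l₁ μ₂ l₂ h₁ h₂ => ?_⟩
  obtain ⟨rfl, rfl⟩ := h₁.unique (hv₁.hasPolarCoeffs hR0 hR)
  obtain ⟨rfl, rfl⟩ := h₂.unique (hv₂.hasPolarCoeffs hR0 hR)
  exact hχ.boundaryTerm_eq hr hrρ hρR hρm hα hv₁ hv₂
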